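/- Let $G$ be a finite group and $p$ a prime. A \emph{chief factor} of $G$ is a quotient $L/K$, where $K<L$ are normal subgroups of $G$ such that no normal subgroup of $G$ lies strictly between $K$ and $L$. A subgroup $H$ of $G$ satisfies the \emph{$\Pi$-property} in $G$ if, for every chief factor $L/K$ of $G$, every prime divisor of the index $|G/K : N_{G/K}(HK/K\cap L/K)|$ divides $|HK/K\cap L/K|$; and $H$ satisfies the \emph{$IC$-$\Pi$-property} in $G$ if $H\cap[H,G]$ satisfies the $\Pi$-property in $G$. The \emph{$p\mathfrak U$-hypercenter} $Z_{p\mathfrak U}(G)$ is the product of all normal subgroups $H$ of $G$ such that every chief factor $L/K$ of $G$ with $L\le H$ and with order divisible by $p$ is cyclic. Theorem. Let $N$ be a normal subgroup of $G$ and let $P$ be a Sylow $p$-subgroup of $N$. If every maximal subgroup of $P$ satisfies the $IC$-$\Pi$-property in $G$, then either $|P|=p$ or $N\le Z_{p\mathfrak U}(G)$. -/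

import Mathlib

/-- `n` is a `π(m)`-number: every prime divisor of `n` divides `m`. -/
def IsPiNumber (m n : ℕ) : Prop :=
  ∀ q : ℕ, q.Prime → q ∣ n → q ∣ m

/-- `L / K` is a chief factor of `G`: `K < L` are normal subgroups of `G` and no normal
subgroup of `G` lies strictly between them. -/
structure IsChiefFactor {G : Type*} [Group G] (K L : Subgroup G) : Prop where
  normal_bot : K.Normal
  normal_top : L.Normal
  lt : K < L
  eq_or_eq : ∀ M : Subgroup G, M.Normal → K ≤ M → M ≤ L → M = K ∨ M = L

/-- The image `HK / K` of a subgroup `H` of `G` in the quotient `G / K`. -/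
def imageMod {G : Type*} [Group G] (K : Subgroup G) [K.Normal] (H : Subgroup G) :
    Subgroup (G ⧸ K) :=
  H.map (QuotientGroup.mk' K)

/-- The `Π`-property of `H` in `G`: for every chief factor `L / K` of `G`, the index
`|G/K : N_{G/K}(HK/K ∩ L/K)|` is a `π(HK/K ∩ L/K)`-number. -/
def SatisfiesPi {G : Type*} [Group G] (H : Subgroup G) : Prop :=
  ∀ (K L : Subgroup G) [K.Normal], IsChiefFactor K L →
    IsPiNumber (Nat.card ↥(imageMod K H ⊓ imageMod K L))
      (Subgroup.normalizer ((imageMod K H ⊓ imageMod K L : Subgroup (G ⧸ K)) : Set (G ⧸ K))).index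

/-- The `IC`-`Π`-property of `H` in `G`: `H ∩ [H, G]` satisfies the `Π`-property in `G`. -/
def SatisfiesICPi {G : Type*} [Group G] (H : Subgroup G) : Prop :=
  SatisfiesPi (H ⊓ ⁅H, (⊤ : Subgroup G)⁆)

/-- Every chief factor `L / K` of `G` below `H` (that is, with `L ≤ H`) whose order is
divisible by `p` is cyclic. -/
def CyclicChiefFactorsBelow (p : ℕ) {G : Type*} [Group G] (H : Subgroup G) : Prop :=
  ∀ (K L : Subgroup G) [K.Normal], IsChiefFactor K L → L ≤ H →
    p ∣ Nat.card ↥(imageMod K L) → IsCyclic ↥(imageMod K L)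

/-- The `pU`-hypercenter of `G`: the product (the subgroup generated by the union) of all
normal subgroups `H` of `G` such that every chief factor of `G` below `H` of order
divisible by `p` is cyclic. -/
def pSupersolubleHypercenter (p : ℕ) (G : Type*) [Group G] : Subgroup G :=
  sSup {H : Subgroup G | H.Normal ∧ CyclicChiefFactorsBelow p H}

namespace ICPi

open Subgroup
open scoped commutatorElement

section

variable {G : Type*} [Group G]

/-! The proof is by induction on `|G|`, assuming `|P| ≠ p`; the goal is that every chief factor of
`G` below `N` of order divisible by `p` has order `p`.

For a `p`-subgroup `H`, the `Π`-property says that each `(H ∩ L)K` has normalizer of `p`-power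
index. Such a normalizer supplements every Sylow `p`-subgroup of `G`. Hence `H` avoids every chief
factor that is not a `p`-group (`PrimePowerPi.relIndex_eq_pow`), and a subgroup `(H ∩ L)K`
normalized by a Sylow `p`-subgroup is normal (`normal_of_sylow_le_normalizer`).

A nontrivial normal `p'`-subgroup of `G` inside `N` can be factored out, so assume there is none,
and let `X ≤ N` be minimal normal. Then `X` is a `p`-group
(`MaximalICPi.isPGroup_of_isChiefFactor`). The factors above `X` come from induction in `G/X`,
except when `|P/X| = p`, where the induction hypothesis is not available; there `|P| = p²` and a
direct argument applies (`MaximalICPi.cyclicBetween_of_relIndex_eq`).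

It remains to see that `|X| = p`. If some maximal subgroup of `P` misses part of `X`, one can be
chosen whose intersection with `X` is normalized by a Sylow `p`-subgroup of `G`, and the
`Π`-property finishes (`MaximalICPi.card_eq_of_not_le`). If `X ≤ Φ(P)`, coprime action and the
Frattini argument show that whatever centralizes the `p`-chief factors above `X` also centralizes
`X`. Those factors have order `p`, so `G` acts on `X` as an abelian group of exponent dividing `p -
1`, and irreducibility forces `|X| = p` (`card_eq_of_le_frattini`). -/

/-- For a `p`-group `H` this is a reformulation of the `Π`-property inside `G`. -/
def PrimePowerPi (p : ℕ) (H : Subgroup G) : Prop :=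
  ∀ K L : Subgroup G, IsChiefFactor K L →
    ∃ n : ℕ, (normalizer (((H ⊓ L) ⊔ K : Subgroup G) : Set G)).index = p ^ n

/-- Every chief factor of `G` between `X` and `N` of order divisible by `p` has order `p`. -/
def CyclicBetween (p : ℕ) (X N : Subgroup G) : Prop :=
  ∀ K L : Subgroup G, IsChiefFactor K L → X ≤ K → L ≤ N →
    p ∣ K.relIndex L → K.relIndex L = p

/-- `P` is a Sylow `p`-subgroup of the subgroup `N` (as subgroups of the ambient group). -/
structure SylowIn (p : ℕ) (P N : Subgroup G) : Prop where
  le : P ≤ N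
  isPGroup : IsPGroup p P
  not_dvd : ¬ p ∣ P.relIndex N

/-! ### Chief factors, relative indices and Sylow subgroups of a subgroup. -/

lemma exists_isChiefFactor_above [Finite G] {X N : Subgroup G} (hX : X.Normal) (hN : N.Normal)
    (h : X < N) : ∃ Y, IsChiefFactor X Y ∧ Y ≤ N := by
  obtain ⟨Y, hY⟩ := (Set.toFinite {M : Subgroup G | M.Normal ∧ X < M ∧ M ≤ N}).exists_minimal
    ⟨N, hN, h, le_rfl⟩
  refine ⟨Y, ⟨hX, hY.1.1, hY.1.2.1, fun M hM h1 h2 => ?_⟩, hY.1.2.2⟩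
  rcases h1.eq_or_lt with h1 | h1
  · exact Or.inl h1.symm
  · exact Or.inr (le_antisymm h2 (hY.2 ⟨hM, h1, h2.trans hY.1.2.2⟩ h2))

lemma exists_isChiefFactor_below [Finite G] {X N : Subgroup G} (hX : X.Normal) (hN : N.Normal)
    (h : X < N) : ∃ Y, IsChiefFactor Y N ∧ X ≤ Y := by
  obtain ⟨Y, hY⟩ := (Set.toFinite {M : Subgroup G | M.Normal ∧ X ≤ M ∧ M < N}).exists_maximal
    ⟨X, hX, le_rfl, h⟩
  refine ⟨Y, ⟨hY.1.1, hN, hY.1.2.2, fun M hM h1 h2 => ?_⟩, hY.1.2.1⟩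
  rcases h2.eq_or_lt with h2 | h2
  · exact Or.inr h2
  · exact Or.inl (le_antisymm (hY.2 ⟨hM, hY.1.2.1.trans h1, h2⟩ h1) h1)

lemma relIndex_sup_self_of_normal [Finite G] {A D : Subgroup G} (hD : D.Normal) :
    A.relIndex (A ⊔ D) = A.relIndex D := by
  have h2 := relIndex_mul_relIndex (A ⊓ D) A (A ⊔ D) inf_le_left le_sup_left
  have h3 := relIndex_mul_relIndex (A ⊓ D) D (A ⊔ D) inf_le_right le_sup_right
  rw [relIndex_sup_right, inf_relIndex_right] at h3
  rw [inf_relIndex_left, ← h3, mul_comm] at h2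
  exact Nat.eq_of_mul_eq_mul_right (Nat.pos_of_ne_zero FiniteIndex.index_ne_zero) h2

/-- `|D : A ∩ D| = |AD : A|`, and `AD` is a subgroup of `N`. -/
lemma relIndex_dvd_of_normal_le [Finite G] {A D N : Subgroup G} (hA : A ≤ N) (hD : D.Normal)
    (hDN : D ≤ N) : A.relIndex D ∣ A.relIndex N := by
  rw [← relIndex_sup_self_of_normal hD]
  exact Dvd.intro _ (relIndex_mul_relIndex A (A ⊔ D) N le_sup_left (sup_le hA hDN))

lemma isPGroup_of_relIndex [Finite G] {p : ℕ} [Fact p.Prime] {K L : Subgroup G} (hKL : K ≤ L)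
    (hK : IsPGroup p K) {m : ℕ} (h : K.relIndex L = p ^ m) : IsPGroup p L := by
  obtain ⟨k, hk⟩ := IsPGroup.iff_card.1 hK
  refine IsPGroup.iff_card.2 ⟨k + m, ?_⟩
  have := relIndex_mul_relIndex ⊥ K L bot_le hKL
  rw [relIndex_bot_left, relIndex_bot_left, hk, h] at this
  rw [← this, pow_add]

lemma exists_relIndex_eq_pow [Finite G] {p : ℕ} [Fact p.Prime] {L : Subgroup G}
    (hL : IsPGroup p L) (K : Subgroup G) : ∃ m, K.relIndex L = p ^ m := by
  obtain ⟨k, hk⟩ := IsPGroup.iff_card.1 hL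
  have h : K.relIndex L ∣ Nat.card L := relIndex_dvd_card K L
  rw [hk] at h
  obtain ⟨m, -, hm⟩ := (Nat.dvd_prime_pow Fact.out).1 h
  exact ⟨m, hm⟩

lemma eq_bot_of_isPGroup_of_not_dvd [Finite G] {p : ℕ} [Fact p.Prime] {L : Subgroup G}
    (hL : IsPGroup p L) (h : ¬ p ∣ Nat.card L) : L = ⊥ := by
  rcases hL.card_eq_or_dvd with h1 | h1
  · exact Subgroup.card_eq_one.1 h1
  · exact absurd h1 h

lemma not_dvd_relIndex_of_le [Finite G] {p : ℕ} {A B N : Subgroup G} (hAB : A ≤ B)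
    (h : ¬ p ∣ A.relIndex N) : ¬ p ∣ B.relIndex N :=
  fun h1 => h (h1.trans (relIndex_dvd_of_le_left N hAB))

namespace SylowIn

variable [Finite G] {p : ℕ} {P N : Subgroup G}

lemma inf_normal (h : SylowIn p P N) {D : Subgroup G} (hD : D.Normal) (hDN : D ≤ N) :
    SylowIn p (P ⊓ D) D :=
  ⟨inf_le_right, h.isPGroup.to_le inf_le_left, fun h1 => h.not_dvd
    ((by rwa [inf_relIndex_right] at h1 : p ∣ P.relIndex D).trans
      (relIndex_dvd_of_normal_le h.le hD hDN))⟩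

lemma not_inf_le (h : SylowIn p P N) {K L : Subgroup G} (hL : L.Normal)
    (hLN : L ≤ N) (hp : p ∣ K.relIndex L) : ¬ P ⊓ L ≤ K := by
  intro h1
  exact not_dvd_relIndex_of_le h1 (h.inf_normal hL hLN).not_dvd hp

variable [Fact p.Prime]

lemma eq_of_le (h : SylowIn p P N) {S : Subgroup G} (hS : IsPGroup p S) (hSN : S ≤ N)
    (hPS : P ≤ S) : S = P := by
  obtain ⟨m, hm⟩ := exists_relIndex_eq_pow hS P
  have h1 := relIndex_mul_relIndex P S N hPS hSN
  rcases m.eq_zero_or_pos with h0 | h0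
  · subst h0
    exact le_antisymm (relIndex_eq_one.1 (by simpa using hm)) hPS
  · exact absurd ((hm ▸ dvd_pow_self p h0.ne' : p ∣ P.relIndex S).trans (Dvd.intro _ h1)) h.not_dvd

lemma le_of_normal (h : SylowIn p P N) {X : Subgroup G} (hX : X.Normal) (hXp : IsPGroup p X)
    (hXN : X ≤ N) : X ≤ P := by
  have h1 : IsPGroup p (P ⊔ X : Subgroup G) := h.isPGroup.to_sup_of_normal_right hXp
  rw [← h.eq_of_le h1 (sup_le h.le hXN) le_sup_left]
  exact le_sup_right

lemma exists_conj (h : SylowIn p P N) {Q : Subgroup G} (hQ : SylowIn p Q N) :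
    ∃ n ∈ N, P.map (MulAut.conj n).toMonoidHom = Q := by
  let P' : Sylow p N := (h.isPGroup.comap_subtype (K := N)).toSylow h.not_dvd
  let Q' : Sylow p N := (hQ.isPGroup.comap_subtype (K := N)).toSylow hQ.not_dvd
  obtain ⟨n, hn⟩ := MulAction.exists_smul_eq N P' Q'
  refine ⟨n, n.2, ?_⟩
  have h1 : ((n • P' : Sylow p N) : Subgroup N).map N.subtype = (Q' : Subgroup N).map N.subtype := by
    rw [hn]
  have h2 : (Q' : Subgroup N).map N.subtype = Q := by
    change (Q.subgroupOf N).map N.subtype = Q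
    rw [subgroupOf_map_subtype, inf_eq_left.2 hQ.le]
  rw [h2] at h1
  rw [← h1]
  ext x
  constructor
  · rintro ⟨y, hy, rfl⟩
    refine ⟨n * ⟨y, h.le hy⟩ * n⁻¹, ?_, by simp⟩
    exact ⟨⟨y, h.le hy⟩, hy, rfl⟩
  · rintro ⟨_, ⟨y, hy, rfl⟩, rfl⟩
    exact ⟨y, hy, by simp [MulAut.conj_apply]⟩

lemma exists_of (p : ℕ) [Fact p.Prime] (N : Subgroup G) : ∃ P, SylowIn p P N := by
  obtain ⟨Q⟩ := (inferInstance : Nonempty (Sylow p N))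
  refine ⟨(Q : Subgroup N).map N.subtype, map_subtype_le _, Q.2.map _, ?_⟩
  rw [relIndex, subgroupOf, comap_map_eq_self_of_injective N.subtype_injective]
  exact Q.not_dvd_index

end SylowIn

/-! ### Subgroups whose normalizer has `p`-power index. -/

/-- The indices of `S` and `A` are coprime, so `S` acts transitively on the cosets of `A`. -/
lemma exists_mul_of_index_eq_pow [Finite G] {p n : ℕ} [Fact p.Prime] {S A : Subgroup G}
    (hS : ¬ p ∣ S.index) (hA : A.index = p ^ n) (g : G) : ∃ s ∈ S, ∃ a ∈ A, g = s * a := by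
  have h1 : A.relIndex S * S.index = S.relIndex A * A.index := by
    rw [← inf_relIndex_right, relIndex_mul_index inf_le_right, ← inf_relIndex_right S,
      relIndex_mul_index inf_le_right, inf_comm]
  have h2 : A.index ∣ A.relIndex S := by
    have h3 : A.index ∣ A.relIndex S * S.index := h1 ▸ Dvd.intro_left _ rfl
    refine Nat.Coprime.dvd_of_dvd_mul_right ?_ h3
    rw [hA]
    exact Nat.Coprime.pow_left _ (((Nat.Prime.coprime_iff_not_dvd Fact.out)).2 hS)
  let f : S ⧸ A.subgroupOf S → G ⧸ A := Quotient.map' (fun s => (s : G)) (by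
    intro a b hab
    rw [QuotientGroup.leftRel_apply] at hab ⊢
    exact hab)
  have hf : Function.Injective f := by
    intro a b
    induction a using QuotientGroup.induction_on
    induction b using QuotientGroup.induction_on
    intro hab
    exact QuotientGroup.eq.2 (QuotientGroup.eq (s := A).1 hab)
  have hle : Nat.card (G ⧸ A) ≤ Nat.card (S ⧸ A.subgroupOf S) :=
    Nat.le_of_dvd Nat.card_pos h2
  have hb := hf.bijective_of_nat_card_le hle
  obtain ⟨y, hy⟩ := hb.2 (g : G ⧸ A)
  induction y using QuotientGroup.induction_on with
  | H s =>
    refine ⟨s, s.2, (s : G)⁻¹ * g, QuotientGroup.eq.1 hy, by group⟩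

lemma normal_of_sylow_le_normalizer [Finite G] {p n : ℕ} [Fact p.Prime] {S A : Subgroup G}
    (hS : ¬ p ∣ S.index) (hA : (normalizer (A : Set G)).index = p ^ n)
    (hSA : S ≤ normalizer (A : Set G)) : A.Normal := by
  have h1 := index_dvd_of_le hSA
  rw [hA] at h1
  have h0 : n = 0 := by
    by_contra h0
    exact hS ((dvd_pow_self p h0).trans h1)
  rw [h0, pow_zero, index_eq_one] at hA
  exact normalizer_eq_top_iff.1 hA

/-- A `p`-subgroup with the `Π`-property avoids every chief factor which is not a `p`-group. -/
lemma PrimePowerPi.relIndex_eq_pow [Finite G] {p : ℕ} [Fact p.Prime] {H : Subgroup G}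
    (h : PrimePowerPi p H) (hH : IsPGroup p H) {K L : Subgroup G} (hKL : IsChiefFactor K L)
    (hHL : ¬ H ⊓ L ≤ K) : ∃ m, K.relIndex L = p ^ m := by
  obtain ⟨n, hn⟩ := h K L hKL
  obtain ⟨S, hHS⟩ := hH.exists_le_sylow
  have := hKL.normal_bot
  have := hKL.normal_top
  set A : Subgroup G := (H ⊓ L) ⊔ K with hA
  have hAL : A ≤ L := sup_le inf_le_right hKL.lt.le
  have hAS : A ≤ (S : Subgroup G) ⊔ K := sup_le (inf_le_left.trans (hHS.trans le_sup_left)) le_sup_right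
  -- Since `G = S · N_G(A)`, every `G`-conjugate of `A` is an `S`-conjugate, hence lies in `SK`. The
  -- normal closure of `A` is `L`, so `L ≤ SK` and `|L/K|` divides the `p`-power `|SK/K|`.
  have hcl : normalClosure (A : Set G) ≤ (S : Subgroup G) ⊔ K := by
    rw [normalClosure, closure_le]
    intro x hx
    obtain ⟨a, ha, hax⟩ := Group.mem_conjugatesOfSet_iff.1 hx
    obtain ⟨g, rfl⟩ := isConj_iff.1 hax
    obtain ⟨s, hs, b, hb, rfl⟩ := exists_mul_of_index_eq_pow S.not_dvd_index hn g
    have h1 : b * a * b⁻¹ ∈ A := (mem_normalizer_iff.1 hb a).1 ha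
    have hs' : s ∈ (S : Subgroup G) ⊔ K := le_sup_left (a := (S : Subgroup G)) hs
    have h2 := mul_mem (mul_mem hs' (hAS h1)) (inv_mem hs')
    simpa [mul_assoc] using h2
  have hclL : normalClosure (A : Set G) = L := by
    rcases hKL.eq_or_eq _ (normalClosure_normal (s := (A : Set G)))
      (le_sup_right.trans le_normalClosure) (normalClosure_le_normal hAL) with h1 | h1
    · exact absurd (le_sup_left.trans (le_normalClosure.trans h1.le)) hHL
    · exact h1
  rw [hclL] at hcl
  have h3 : K.relIndex L ∣ K.relIndex (S : Subgroup G) := by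
    rw [← relIndex_sup_right (S : Subgroup G) K]
    exact Dvd.intro _ (relIndex_mul_relIndex K L _ hKL.lt.le hcl)
  obtain ⟨k, hk⟩ := exists_relIndex_eq_pow S.2 K
  have h4 : K.relIndex L ∣ p ^ k := hk ▸ h3
  obtain ⟨m, -, hm⟩ := (Nat.dvd_prime_pow Fact.out).1 h4
  exact ⟨m, hm⟩

/-- Gluing chief factors below `X` and between `X` and `N`. -/
lemma CyclicBetween.trans {p : ℕ} {X N : Subgroup G} (hX : X.Normal)
    (h1 : CyclicBetween p ⊥ X) (h2 : CyclicBetween p X N) (hXN : X ≤ N) :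
    CyclicBetween p ⊥ N := by
  intro K L hKL _ hLN hp
  have := hKL.normal_bot
  have := hKL.normal_top
  -- Either `L/K` is isomorphic to the chief factor `LX/KX` above `X`, or `L = (L ∩ X)K` and it is
  -- isomorphic to the chief factor `(L ∩ X)/(K ∩ X)` below `X`.
  by_cases hc : L ⊓ X ≤ K
  · have hidx : (K ⊔ X).relIndex (L ⊔ X) = K.relIndex L := by
      have h5 : L ⊔ X = L ⊔ (K ⊔ X) := by rw [← sup_assoc, sup_eq_left.2 hKL.lt.le]
      rw [h5, relIndex_sup_right, ← inf_relIndex_right]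
      congr 1
      refine le_antisymm ?_ (le_inf le_sup_left hKL.lt.le)
      rw [sup_comm, inf_comm]
      intro x hx
      obtain ⟨hxL, hx⟩ := mem_inf.1 hx
      obtain ⟨y, hy, z, hz, rfl⟩ := mem_sup_of_normal_right.1 hx
      exact mul_mem (hc ⟨by simpa using mul_mem hxL (inv_mem (hKL.lt.le hz)), hy⟩) hz
    rw [← hidx] at hp ⊢
    refine h2 _ _ ⟨inferInstance, inferInstance, ?_, ?_⟩ le_sup_right (sup_le hLN hXN) hp
    · refine lt_of_le_of_ne (sup_le_sup_right hKL.lt.le X) fun he => ?_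
      have h6 : K.relIndex L = 1 := by rw [← hidx, he, relIndex_self]
      exact hKL.lt.not_ge (relIndex_eq_one.1 h6)
    · intro M hM hKM hML
      have hmod : M = (M ⊓ L) ⊔ X := by
        refine le_antisymm ?_ (sup_le inf_le_left (le_sup_right.trans hKM))
        intro x hx
        obtain ⟨y, hy, z, hz, rfl⟩ := mem_sup_of_normal_right.1 (hML hx)
        refine mul_mem (le_sup_left (a := M ⊓ L) ⟨?_, hy⟩) (le_sup_right (a := M ⊓ L) hz)
        simpa using mul_mem hx (inv_mem (hKM (le_sup_right (a := K) hz)))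
      rcases hKL.eq_or_eq (M ⊓ L) inferInstance (le_inf (le_sup_left.trans hKM) hKL.lt.le)
        inf_le_right with h6 | h6
      · left; rw [hmod, h6]
      · right; rw [hmod, h6]
  · have hL : (L ⊓ X) ⊔ K = L := by
      rcases hKL.eq_or_eq ((L ⊓ X) ⊔ K) inferInstance le_sup_right (sup_le inf_le_left hKL.lt.le) with h6 | h6
      · exact absurd (h6 ▸ le_sup_left) hc
      · exact h6
    have hidx : (K ⊓ X).relIndex (L ⊓ X) = K.relIndex L := by
      nth_rw 2 [← hL]
      rw [relIndex_sup_right, ← inf_relIndex_right K]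
      congr 1
      rw [← inf_assoc, inf_eq_left.2 hKL.lt.le]
    rw [← hidx] at hp ⊢
    refine h1 _ _ ⟨inferInstance, inferInstance, ?_, ?_⟩ bot_le inf_le_right hp
    · refine lt_of_le_of_ne (inf_le_inf_right X hKL.lt.le) fun he => ?_
      exact hc (he ▸ inf_le_left)
    · intro M hM hKM hML
      rcases hKL.eq_or_eq (M ⊔ K) inferInstance le_sup_right
        (sup_le (hML.trans inf_le_left) hKL.lt.le) with h6 | h6
      · left
        exact le_antisymm (le_inf (h6 ▸ le_sup_left) (hML.trans inf_le_right)) hKM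
      · right
        refine le_antisymm hML fun x hx => ?_
        obtain ⟨hxL, hxX⟩ := mem_inf.1 hx
        rw [← h6] at hxL
        obtain ⟨y, hy, z, hz, rfl⟩ := mem_sup_of_normal_right.1 hxL
        refine mul_mem hy (hKM ⟨hz, ?_⟩)
        simpa using mul_mem (inv_mem (mem_inf.1 (hML hy)).2) hxX

lemma CyclicBetween.of_card_eq {p : ℕ} {X : Subgroup G}
    (hX : Nat.card X = p) (hmin : IsChiefFactor ⊥ X) : CyclicBetween p ⊥ X := by
  intro K L hKL _ hLX _
  have := hKL.normal_bot
  have := hKL.normal_top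
  rcases hmin.eq_or_eq L inferInstance bot_le hLX with h | h
  · exact absurd (h ▸ hKL.lt) not_lt_bot
  · rcases hmin.eq_or_eq K inferInstance bot_le (hKL.lt.le.trans hLX) with h' | h'
    · rw [h, h', relIndex_bot_left, hX]
    · exact absurd hKL.lt (by rw [h, h']; exact lt_irrefl _)

lemma CyclicBetween.of_not_dvd [Finite G] {p : ℕ} {X : Subgroup G} (hX : ¬ p ∣ Nat.card X) :
    CyclicBetween p ⊥ X := by
  intro K L hKL _ hLX hp
  exact absurd ((hp.trans (relIndex_dvd_card K L)).trans (card_dvd_of_le hLX)) hX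

/-- `M ∩ [M, G]` has the `Π`-property for all maximal subgroups `M` of `P`. -/
def MaximalICPi (p : ℕ) (P : Subgroup G) : Prop :=
  ∀ M : Subgroup G, M ⋖ P → PrimePowerPi p (M ⊓ ⁅M, (⊤ : Subgroup G)⁆)

instance commutator_top_normal (M : Subgroup G) : (⁅M, (⊤ : Subgroup G)⁆).Normal := by
  refine ⟨fun n hn g => ?_⟩
  have h : ⁅M, (⊤ : Subgroup G)⁆ ≤ (⁅M, (⊤ : Subgroup G)⁆).comap (MulAut.conj g).toMonoidHom := by
    refine commutator_le.2 fun m hm h _ => ?_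
    have h1 : (MulAut.conj g).toMonoidHom ⁅m, h⁆ = ⁅m, g⁆⁻¹ * ⁅m, g * h⁆ := by
      simp only [MulEquiv.coe_toMonoidHom, MulAut.conj_apply, commutatorElement_def]
      group
    rw [mem_comap, h1]
    exact mul_mem (inv_mem (commutator_mem_commutator hm (mem_top g)))
      (commutator_mem_commutator hm (mem_top _))
  exact h hn

lemma sup_inf_of_le {H K L : Subgroup G} (hK : K.Normal) (hKL : K ≤ L) :
    (H ⊔ K) ⊓ L = (H ⊓ L) ⊔ K := by
  refine le_antisymm ?_ (le_inf (sup_le_sup_right inf_le_left K) (sup_le inf_le_right hKL))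
  intro x hx
  obtain ⟨hx, hxL⟩ := mem_inf.1 hx
  obtain ⟨y, hy, z, hz, rfl⟩ := mem_sup_of_normal_right.1 hx
  refine mul_mem (le_sup_left (a := H ⊓ L) ⟨hy, ?_⟩) (le_sup_right (a := H ⊓ L) hz)
  simpa using mul_mem hxL (inv_mem (hKL hz))

lemma _root_.SatisfiesPi.primePowerPi [Finite G] {p : ℕ} [Fact p.Prime] {H : Subgroup G}
    (h : SatisfiesPi H) (hH : IsPGroup p H) : PrimePowerPi p H := by
  intro K L hKL
  have := hKL.normal_bot
  have h1 := h K L hKL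
  have hs := QuotientGroup.mk'_surjective K
  have h2 : ((imageMod K H ⊓ imageMod K L : Subgroup (G ⧸ K))).comap (QuotientGroup.mk' K)
      = (H ⊓ L) ⊔ K := by
    rw [comap_inf, imageMod, imageMod, comap_map_eq, comap_map_eq, QuotientGroup.ker_mk',
      sup_eq_left.2 hKL.lt.le, sup_inf_of_le hKL.normal_bot hKL.lt.le]
  have h3 : (normalizer (((H ⊓ L) ⊔ K : Subgroup G) : Set G)).index =
      (normalizer ((imageMod K H ⊓ imageMod K L : Subgroup (G ⧸ K)) : Set (G ⧸ K))).index := by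
    rw [← h2, ← comap_normalizer_eq_of_surjective _ hs, index_comap_of_surjective _ hs]
  rw [h3]
  obtain ⟨k, hk⟩ := IsPGroup.iff_card.1
    ((hH.map (QuotientGroup.mk' K)).to_le (inf_le_left (b := imageMod K L)))
  refine ⟨_, Nat.eq_prime_pow_of_unique_prime_dvd FiniteIndex.index_ne_zero fun hd hdd => ?_⟩
  have h4 := h1 _ hd hdd
  change _ ∣ Nat.card ↥(map (QuotientGroup.mk' K) H ⊓ imageMod K L) at h4
  rw [hk] at h4
  exact (Nat.prime_dvd_prime_iff_eq hd Fact.out).1 (hd.dvd_of_dvd_pow h4)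

/-! ### Passage to quotients. -/

section map

variable {G' : Type*} [Group G'] {f : G →* G'}

lemma isChiefFactor_comap (hf : Function.Surjective f) {K L : Subgroup G'}
    (h : IsChiefFactor K L) : IsChiefFactor (K.comap f) (L.comap f) := by
  have := h.normal_bot
  have := h.normal_top
  refine ⟨inferInstance, inferInstance, (comap_lt_comap_of_surjective hf).2 h.lt, ?_⟩
  intro M hM h1 h2
  have hker : f.ker ≤ M := (f.ker_le_comap K).trans h1
  rw [← comap_map_eq_self hker]
  rcases h.eq_or_eq (M.map f) (hM.map f hf)
    ((map_comap_eq_self_of_surjective hf K).symm.le.trans (map_mono h1)) (map_le_iff_le_comap.2 h2)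
    with h3 | h3
  · left; rw [h3]
  · right; rw [h3]

lemma isChiefFactor_map (hf : Function.Surjective f) {K L : Subgroup G} (hK : f.ker ≤ K)
    (h : IsChiefFactor K L) : IsChiefFactor (K.map f) (L.map f) := by
  refine ⟨h.normal_bot.map f hf, h.normal_top.map f hf, ?_, ?_⟩
  · rw [← comap_lt_comap_of_surjective hf, comap_map_eq_self hK,
      comap_map_eq_self (hK.trans h.lt.le)]
    exact h.lt
  · intro M hM h1 h2
    have h3 := comap_mono (f := f) h1
    have h4 := comap_mono (f := f) h2
    rw [comap_map_eq_self hK] at h3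
    rw [comap_map_eq_self (hK.trans h.lt.le)] at h4
    rw [← map_comap_eq_self_of_surjective hf M]
    rcases h.eq_or_eq _ (hM.comap f) h3 h4 with h5 | h5
    · left; rw [h5]
    · right; rw [h5]

lemma CyclicBetween.of_map (hf : Function.Surjective f) {p : ℕ} {N : Subgroup G}
    (h : CyclicBetween p ⊥ (N.map f)) : CyclicBetween p f.ker N := by
  intro K L hKL hK hL hp
  have h1 : (K.map f).relIndex (L.map f) = K.relIndex L := by
    rw [relIndex_map_map, sup_eq_left.2 hK, sup_eq_left.2 (hK.trans hKL.lt.le)]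
  rw [← h1] at hp ⊢
  exact h _ _ (isChiefFactor_map hf hK hKL) bot_le (map_mono hL) hp

lemma PrimePowerPi.map (hf : Function.Surjective f) {p : ℕ} {H : Subgroup G}
    (h : PrimePowerPi p H) : PrimePowerPi p (H.map f) := by
  intro K L hKL
  obtain ⟨n, hn⟩ := h _ _ (isChiefFactor_comap hf hKL)
  refine ⟨n, ?_⟩
  have h1 : ((H.map f ⊓ L) ⊔ K).comap f = (H ⊓ L.comap f) ⊔ K.comap f := by
    rw [← sup_inf_of_le hKL.normal_bot hKL.lt.le,
      ← sup_inf_of_le (hKL.normal_bot.comap f) (comap_mono hKL.lt.le), comap_inf]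
    congr 1
    rw [← comap_sup_eq f _ _ hf, comap_map_eq, sup_assoc, sup_eq_right.2 (f.ker_le_comap K)]
  rw [← hn, ← h1, ← comap_normalizer_eq_of_surjective _ hf, index_comap_of_surjective _ hf]

/-- An element on the right is `f m = f d` with `m ∈ M`, `d ∈ [M, G]`, so `d⁻¹m` lies in the kernel.
If the kernel is inside `M`, then `d ∈ M`. If it is a `p'`-group, the order of `m` modulo `[M, G]`
divides both a power of `p` and the order of the kernel, so `m ∈ [M, G]`. -/
lemma map_inf_commutator {p : ℕ} [Fact p.Prime] (hf : Function.Surjective f) {M : Subgroup G}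
    (hM : IsPGroup p M) (hker : f.ker ≤ M ∨ ¬ p ∣ Nat.card f.ker) :
    (M ⊓ ⁅M, (⊤ : Subgroup G)⁆).map f = M.map f ⊓ ⁅M.map f, (⊤ : Subgroup G')⁆ := by
  have hD : ⁅M.map f, (⊤ : Subgroup G')⁆ = ⁅M, (⊤ : Subgroup G)⁆.map f := by
    rw [map_commutator, map_top_of_surjective f hf]
  rw [hD]
  refine le_antisymm (map_inf_le _ _ f) ?_
  rintro _ ⟨⟨m, hm, rfl⟩, ⟨d, hd, hdm⟩⟩
  have hx : d⁻¹ * m ∈ f.ker := by rw [MonoidHom.mem_ker, map_mul, map_inv, hdm]; simp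
  rcases hker with hk | hk
  · refine ⟨d, ⟨?_, hd⟩, hdm⟩
    have := mul_mem hm (inv_mem (hk hx))
    simpa using this
  · refine ⟨m, ⟨hm, ?_⟩, rfl⟩
    set D := ⁅M, (⊤ : Subgroup G)⁆ with hDdef
    have hDn : D.Normal := commutator_top_normal M
    have h1 : (m : G ⧸ D) = ((d⁻¹ * m : G) : G ⧸ D) := by
      rw [QuotientGroup.mk_mul, QuotientGroup.mk_inv, (QuotientGroup.eq_one_iff d).2 hd]; simp
    have hpow : (d⁻¹ * m) ^ Nat.card f.ker = 1 :=
      congrArg Subtype.val (pow_card_eq_one' (x := (⟨_, hx⟩ : f.ker)))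
    have h2 : orderOf (m : G ⧸ D) ∣ Nat.card f.ker := by
      rw [h1, orderOf_dvd_iff_pow_eq_one, ← QuotientGroup.mk_pow,
        hpow]
      rfl
    obtain ⟨k, hk'⟩ := hM ⟨m, hm⟩
    have h3 : orderOf (m : G ⧸ D) ∣ p ^ k := by
      rw [orderOf_dvd_iff_pow_eq_one, ← QuotientGroup.mk_pow]
      have : m ^ p ^ k = 1 := congrArg Subtype.val hk'
      rw [this]; rfl
    have h4 : Nat.Coprime (p ^ k) (Nat.card f.ker) :=
      Nat.Coprime.pow_left _ ((Nat.Prime.coprime_iff_not_dvd Fact.out).2 hk)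
    have h5 := Nat.eq_one_of_dvd_coprimes h4 h3 h2
    exact (QuotientGroup.eq_one_iff m).1 (orderOf_eq_one_iff.1 h5)

lemma MaximalICPi.map {p : ℕ} [Fact p.Prime] (hf : Function.Surjective f) {P : Subgroup G}
    (hP : IsPGroup p P) (h : MaximalICPi p P) (hker : f.ker ≤ P ∨ ¬ p ∣ Nat.card f.ker) :
    MaximalICPi p (P.map f) := by
  intro M' hM'
  have hmap : (M'.comap f ⊓ P).map f = M' := by
    refine le_antisymm ((map_mono inf_le_left).trans (map_comap_le f M')) fun y hy => ?_
    obtain ⟨x, hx, rfl⟩ := hM'.lt.le hy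
    exact ⟨x, ⟨hy, hx⟩, rfl⟩
  have hcov : (M'.comap f ⊓ P) ⋖ P := by
    refine ⟨lt_of_le_of_ne inf_le_right fun he => ?_, fun Y hY hYP => ?_⟩
    · rw [he] at hmap
      exact hM'.lt.ne' hmap
    · have h1 : M' ≤ Y.map f := hmap ▸ map_mono hY.le
      have hYeq : Y = (Y.map f).comap f ⊓ P := by
        refine le_antisymm (le_inf (le_comap_map f Y) hYP.le) ?_
        rintro x ⟨⟨y, hy, hyx⟩, hxP⟩
        have h2 : y⁻¹ * x ∈ M'.comap f ⊓ P :=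
          mem_inf.2 ⟨by rw [mem_comap, map_mul, map_inv, hyx, inv_mul_cancel]; exact one_mem _,
            mul_mem (inv_mem (hYP.le hy)) hxP⟩
        simpa using mul_mem hy (hY.le h2)
      rcases h1.eq_or_lt with h2 | h2
      · rw [← h2] at hYeq
        exact hY.ne hYeq.symm
      · refine hM'.2 h2 (lt_of_le_of_ne (map_mono hYP.le) fun he => ?_)
        rw [he] at hYeq
        exact hYP.ne (hYeq.trans (inf_eq_right.2 (le_comap_map f P)))
  have h1 := (h _ hcov).map hf
  rw [map_inf_commutator hf (hP.to_le inf_le_right), hmap] at h1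
  · exact h1
  · exact hker.imp_left fun hk => le_inf (f.ker_le_comap M') hk

variable [Finite G]

lemma SylowIn.map {p : ℕ} {P N : Subgroup G} (h : SylowIn p P N)
    (hN : f.ker ≤ N) : SylowIn p (P.map f) (N.map f) := by
  refine ⟨map_mono h.le, h.isPGroup.map f, ?_⟩
  rw [relIndex_map_map, sup_eq_left.2 hN]
  exact not_dvd_relIndex_of_le le_sup_left h.not_dvd

lemma card_map_of_not_dvd {p : ℕ} [Fact p.Prime] {P : Subgroup G} (hP : IsPGroup p P)
    (hker : ¬ p ∣ Nat.card f.ker) : Nat.card (P.map f) = Nat.card P := by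
  have h1 : f.ker ⊓ P = ⊥ := eq_bot_of_isPGroup_of_not_dvd (hP.to_le inf_le_right)
    fun h => hker (h.trans (card_dvd_of_le inf_le_left))
  rw [← relIndex_ker, ← inf_relIndex_right, h1, relIndex_bot_left]

end map

/-! ### Maximal subgroups of `p`-groups and the Frattini subgroup. -/

lemma map_subtype_covBy_iff {S : Subgroup G} {H K : Subgroup S} :
    H.map S.subtype ⋖ K.map S.subtype ↔ H ⋖ K := by
  let f : Subgroup S ↪o Subgroup G :=
    { toFun := fun A => A.map S.subtype
      inj' := map_injective S.subtype_injective
      map_rel_iff' := map_le_map_iff_of_injective S.subtype_injective }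
  refine Set.OrdConnected.apply_covBy_apply_iff f ⟨?_⟩
  rintro _ ⟨A, rfl⟩ _ ⟨B, rfl⟩ C hC
  refine ⟨C.subgroupOf S, ?_⟩
  change (C.subgroupOf S).map S.subtype = C
  rw [subgroupOf_map_subtype, inf_eq_left]
  exact hC.2.trans (map_subtype_le B)

lemma covBy_of_relIndex_eq_prime [Finite G] {p : ℕ} [hp : Fact p.Prime] {M P : Subgroup G}
    (hMP : M ≤ P) (h : M.relIndex P = p) : M ⋖ P := by
  refine ⟨lt_of_le_of_ne hMP fun he => ?_, fun Y h1 h2 => ?_⟩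
  · rw [he, relIndex_self] at h
    exact hp.out.one_lt.ne h
  · have h3 := relIndex_mul_relIndex M Y P h1.le h2.le
    rw [h] at h3
    rcases (Nat.dvd_prime hp.out).1 (Dvd.intro _ h3) with h4 | h4
    · exact h1.not_ge (relIndex_eq_one.1 h4)
    · rw [h4] at h3
      have h5 : Y.relIndex P = 1 := Nat.eq_of_mul_eq_mul_left hp.out.pos (by rw [h3, mul_one])
      exact h2.not_ge (relIndex_eq_one.1 h5)

lemma index_eq_of_isCoatom {T : Type*} [Group T] [Finite T] {p : ℕ} [hp : Fact p.Prime]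
    (hT : IsPGroup p T) {M : Subgroup T} (hM : IsCoatom M) : M.Normal ∧ M.index = p := by
  have := hT.isNilpotent
  have hn : M.Normal := Group.normalizerCondition_of_isNilpotent.normal_of_coatom _ hM
  refine ⟨hn, ?_⟩
  have hQ : IsPGroup p (T ⧸ M) := hT.to_quotient M
  have hnt : Nontrivial (T ⧸ M) := by
    by_contra hc
    rw [not_nontrivial_iff_subsingleton] at hc
    exact hM.1 (index_eq_one.1 (Nat.card_eq_one_iff_unique.2 ⟨hc, ⟨1⟩⟩))
  obtain ⟨n, hn0, hn⟩ := hQ.nontrivial_iff_card.1 hnt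
  obtain ⟨z, hz⟩ := exists_prime_orderOf_dvd_card' p (hn ▸ dvd_pow_self p hn0.ne' : p ∣ Nat.card (T ⧸ M))
  have h1 : M < (zpowers z).comap (QuotientGroup.mk' M) := by
    refine lt_of_le_of_ne ?_ fun he => ?_
    · intro m hm
      rw [mem_comap, QuotientGroup.mk'_apply, (QuotientGroup.eq_one_iff m).2 hm]
      exact one_mem _
    · obtain ⟨y, rfl⟩ := QuotientGroup.mk'_surjective M z
      have : y ∈ M := by rw [he]; exact mem_zpowers _
      rw [QuotientGroup.mk'_apply, (QuotientGroup.eq_one_iff y).2 this, orderOf_one] at hz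
      exact hp.out.one_lt.ne hz
  have h2 := hM.2 _ h1
  have h3 : zpowers z = ⊤ := by
    rw [← map_comap_eq_self_of_surjective (QuotientGroup.mk'_surjective M) (zpowers z), h2,
      map_top_of_surjective _ (QuotientGroup.mk'_surjective M)]
  rw [index_eq_card, ← card_top, ← h3, Nat.card_zpowers, hz]

lemma relIndex_eq_of_covBy [Finite G] {p : ℕ} [hp : Fact p.Prime] {M P : Subgroup G}
    (hP : IsPGroup p P) (hM : M ⋖ P) : (M.subgroupOf P).Normal ∧ M.relIndex P = p := by
  refine index_eq_of_isCoatom hP ?_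
  rw [← covBy_top_iff, ← map_subtype_covBy_iff, subgroupOf_map_subtype, inf_eq_left.2 hM.lt.le,
    ← MonoidHom.range_eq_map, range_subtype]
  exact hM

/-- In the elementary abelian quotient `T/W`, choose `M` maximal among the subgroups avoiding `x`.
Then every nontrivial cyclic subgroup of `T/M` contains the image of `x`; all of them have order
`p`, so `T/M` is generated by that image. -/
lemma exists_index_eq_prime_notMem {T : Type*} [Group T] [Finite T] {p : ℕ} [hp : Fact p.Prime]
    {W : Subgroup T} (hc : commutator T ≤ W) (hpow : ∀ z : T, z ^ p ∈ W) {x : T} (hx : x ∉ W) :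
    ∃ M : Subgroup T, W ≤ M ∧ x ∉ M ∧ M.index = p := by
  obtain ⟨M, hM⟩ := (Set.toFinite {M : Subgroup T | W ≤ M ∧ x ∉ M}).exists_maximal ⟨W, le_rfl, hx⟩
  obtain ⟨⟨hWM, hxM⟩, hmax⟩ := hM
  have hMn : M.Normal := Subgroup.Normal.of_commutator_le _ (hc.trans hWM)
  refine ⟨M, hWM, hxM, ?_⟩
  have hord : ∀ z : T, z ∉ M → orderOf (z : T ⧸ M) = p := fun z hz => by
    refine orderOf_eq_prime ?_ fun h => hz ((QuotientGroup.eq_one_iff z).1 h)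
    rw [← QuotientGroup.mk_pow]
    exact (QuotientGroup.eq_one_iff _).2 (hWM (hpow z))
  have hmem : ∀ z : T, z ∉ M → (x : T ⧸ M) ∈ zpowers (z : T ⧸ M) := fun z hz => by
    by_contra h
    have h1 := hmax (y := (zpowers (z : T ⧸ M)).comap (QuotientGroup.mk' M)) ⟨hWM.trans ?_, h⟩ ?_
    · exact hz (h1 (mem_zpowers (z : T ⧸ M)))
    all_goals
      intro m hm
      rw [mem_comap, QuotientGroup.mk'_apply, (QuotientGroup.eq_one_iff m).2 hm]
      exact one_mem _
  have htop : zpowers (x : T ⧸ M) = ⊤ := by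
    rw [eq_top_iff]
    intro z _
    induction z using QuotientGroup.induction_on with
    | H z =>
      by_cases hz : z ∈ M
      · rw [(QuotientGroup.eq_one_iff z).2 hz]
        exact one_mem _
      · have h1 : zpowers (x : T ⧸ M) ≤ zpowers (z : T ⧸ M) := zpowers_le.2 (hmem z hz)
        have h2 := Subgroup.eq_of_le_of_card_ge h1
          (by rw [Nat.card_zpowers, Nat.card_zpowers, hord z hz, hord x hxM])
        rw [h2]
        exact mem_zpowers _
  rw [index_eq_card, ← card_top, ← htop, Nat.card_zpowers, hord x hxM]

/-- Iterating the hypothesis pushes `X` into `γₙ(S)F` for every `n`, and `γₙ(S)` is eventually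
trivial. -/
lemma le_of_le_commutator_sup {S : Type*} [Group S] [Group.IsNilpotent S] {X F : Subgroup S}
    (hF : F.Normal) (h : X ≤ ⁅X, (⊤ : Subgroup S)⁆ ⊔ F) : X ≤ F := by
  obtain ⟨n, hn⟩ := (Subgroup.nilpotent_iff_lowerCentralSeries (G := S)).1 inferInstance
  have key : ∀ n, X ≤ (⊤ : Subgroup S).lowerCentralSeries n ⊔ F := by
    intro n
    induction n with
    | zero => simp
    | succ n ih =>
      set C : Subgroup S := (⊤ : Subgroup S).lowerCentralSeries (n + 1) with hC
      refine h.trans (sup_le ?_ le_sup_right)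
      rw [commutator_le]
      intro x hx s _
      obtain ⟨c, hc, f, hf, rfl⟩ := mem_sup_of_normal_right.1 (ih hx)
      have h1 : ⁅c * f, s⁆ = c * ⁅f, s⁆ * c⁻¹ * ⁅c, s⁆ := by
        simp only [commutatorElement_def]; group
      rw [h1]
      refine mul_mem (le_sup_right (a := C) ?_) (le_sup_left (a := C) ?_)
      · refine hF.conj_mem _ ?_ c
        rw [commutatorElement_def, mul_assoc, mul_assoc]
        refine mul_mem hf ?_
        rw [← mul_assoc]
        exact hF.conj_mem _ (inv_mem hf) s
      · exact commutator_mem_commutator hc (mem_top s)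
  have := key n
  rwa [hn, bot_sup_eq] at this

lemma commutator_le_of_index_eq_prime {T : Type*} [Group T] [Finite T] {p : ℕ} [hp : Fact p.Prime]
    {M : Subgroup T} (hM : M.Normal) (h : M.index = p) : commutator T ≤ M := by
  have h1 : IsCyclic (T ⧸ M) := isCyclic_of_prime_card (p := p) (by rw [← index_eq_card, h])
  rw [_root_.commutator_def, commutator_le]
  intro a _ b _
  rw [← QuotientGroup.eq_one_iff, commutatorElement_def]
  obtain ⟨g, hg⟩ := h1.exists_generator
  obtain ⟨i, hi⟩ := mem_zpowers_iff.1 (hg (a : T ⧸ M))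
  obtain ⟨j, hj⟩ := mem_zpowers_iff.1 (hg (b : T ⧸ M))
  rw [QuotientGroup.mk_mul, QuotientGroup.mk_mul, QuotientGroup.mk_mul, QuotientGroup.mk_inv,
    QuotientGroup.mk_inv, ← hi, ← hj]
  group

/-- The intersection of `P` with all its maximal subgroups. -/
def frattiniIn (P : Subgroup G) : Subgroup G := P ⊓ ⨅ M : {M : Subgroup G // M ⋖ P}, M.1

lemma mem_frattiniIn {P : Subgroup G} {x : G} :
    x ∈ frattiniIn P ↔ x ∈ P ∧ ∀ M, M ⋖ P → x ∈ M := by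
  simp [frattiniIn, mem_inf, mem_iInf]

lemma map_conj_covBy {P M : Subgroup G} (g : G) (h : M ⋖ P) :
    M.map (MulAut.conj g).toMonoidHom ⋖ P.map (MulAut.conj g).toMonoidHom :=
  (apply_covBy_apply_iff (MulEquiv.mapSubgroup (MulAut.conj g))).2 h

lemma map_conj_eq_of_normal {X : Subgroup G} (hX : X.Normal) (g : G) :
    X.map (MulAut.conj g).toMonoidHom = X := by
  have := hX
  exact Normal.map_conj_eq X g

lemma frattiniIn_normal {P : Subgroup G} (hP : P.Normal) : (frattiniIn P).Normal := by
  refine ⟨fun n hn g => ?_⟩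
  rw [mem_frattiniIn] at hn ⊢
  refine ⟨hP.conj_mem n hn.1 g, fun M hM => ?_⟩
  have h1 := map_conj_covBy g⁻¹ hM
  rw [map_conj_eq_of_normal hP] at h1
  obtain ⟨m, hm, hmn⟩ := hn.2 _ h1
  have h2 : m = g * n * g⁻¹ := by
    rw [← hmn]; simp [mul_assoc]
  rwa [← h2]

lemma commutator_le_frattiniIn [Finite G] {p : ℕ} [Fact p.Prime] {P : Subgroup G}
    (hP : IsPGroup p P) : commutator P ≤ (frattiniIn P).subgroupOf P := by
  intro z hz
  rw [mem_subgroupOf, mem_frattiniIn]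
  refine ⟨z.2, fun M hM => ?_⟩
  obtain ⟨h1, h2⟩ := relIndex_eq_of_covBy hP hM
  exact commutator_le_of_index_eq_prime h1 h2 hz

lemma pow_mem_frattiniIn [Finite G] {p : ℕ} [Fact p.Prime] {P : Subgroup G}
    (hP : IsPGroup p P) {z : G} (hz : z ∈ P) : z ^ p ∈ frattiniIn P := by
  rw [mem_frattiniIn]
  refine ⟨pow_mem hz p, fun M hM => ?_⟩
  obtain ⟨h1, h2⟩ := relIndex_eq_of_covBy hP hM
  have h3 := Subgroup.pow_index_mem (M.subgroupOf P) (⟨z, hz⟩ : P)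
  rw [← relIndex, h2] at h3
  exact h3

/-- By nilpotency, `X` is not inside `W = [X, S]Φ(P)`. A maximal subgroup `M` of `P` that contains
`W` but not `X` works: `[M ∩ X, S] ≤ [X, S] ≤ M` makes `M ∩ X` normal in `S`. -/
lemma exists_covBy_inf_normal {S : Type*} [Group S] [Finite S] {p : ℕ} [Fact p.Prime]
    (hS : IsPGroup p S) {P X M₀ : Subgroup S} (hP : P.Normal) (hX : X.Normal) (hXP : X ≤ P)
    (hM₀ : M₀ ⋖ P) (hXM₀ : ¬ X ≤ M₀) : ∃ M, M ⋖ P ∧ ¬ X ≤ M ∧ (M ⊓ X).Normal := by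
  have := hS.isNilpotent
  set W : Subgroup S := ⁅X, (⊤ : Subgroup S)⁆ ⊔ frattiniIn P with hW
  have hXW : ¬ X ≤ W := fun h => hXM₀ fun x hx =>
    (mem_frattiniIn.1 (le_of_le_commutator_sup (frattiniIn_normal hP) h hx)).2 M₀ hM₀
  obtain ⟨x, hxX, hxW⟩ := SetLike.not_le_iff_exists.1 hXW
  obtain ⟨M, hWM, hxM, hMi⟩ := exists_index_eq_prime_notMem (W := W.subgroupOf P)
    (x := ⟨x, hXP hxX⟩) (p := p)
    ((commutator_le_frattiniIn (hS.to_subgroup P)).trans (comap_mono le_sup_right))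
    (fun z => le_sup_right (a := ⁅X, (⊤ : Subgroup S)⁆) (pow_mem_frattiniIn (hS.to_subgroup P) z.2)) hxW
  have hWP : W ≤ P := sup_le ((commutator_le_left X ⊤).trans hXP) inf_le_left
  have hWM' : W ≤ M.map P.subtype := fun w hw => ⟨⟨w, hWP hw⟩, hWM hw, rfl⟩
  refine ⟨M.map P.subtype, covBy_of_relIndex_eq_prime (p := p) (map_subtype_le M) ?_, ?_, ?_⟩
  · rw [relIndex, subgroupOf, comap_map_eq_self_of_injective P.subtype_injective, hMi]
  · intro h
    obtain ⟨y, hy, hyx⟩ := h hxX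
    have h4 : y = ⟨x, hXP hxX⟩ := Subtype.ext hyx
    exact hxM (h4 ▸ hy)
  · refine ⟨fun n hn g => ?_⟩
    obtain ⟨h1, h2⟩ := mem_inf.1 hn
    refine mem_inf.2 ⟨?_, hX.conj_mem n h2 g⟩
    have h3 : ⁅n, g⁆ ∈ M.map P.subtype :=
      hWM' (le_sup_left (b := frattiniIn P) (commutator_mem_commutator h2 (mem_top g)))
    have h4 : g * n * g⁻¹ = ⁅n, g⁆⁻¹ * n := by
      simp only [commutatorElement_def]; group
    rw [h4]
    exact mul_mem (inv_mem h3) h1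

lemma exists_covBy_le_normalizer_inf [Finite G] {p : ℕ} [Fact p.Prime] {S P X M₀ : Subgroup G}
    (hS : IsPGroup p S) (hPS : P ≤ S) (hSP : S ≤ normalizer (P : Set G)) (hX : X.Normal)
    (hXP : X ≤ P) (hM₀ : M₀ ⋖ P) (hXM₀ : ¬ X ≤ M₀) :
    ∃ M, M ⋖ P ∧ ¬ X ≤ M ∧ S ≤ normalizer ((M ⊓ X : Subgroup G) : Set G) := by
  have key : ∀ A : Subgroup G, A ≤ S → (A.subgroupOf S).map S.subtype = A := fun A hA => by
    rw [subgroupOf_map_subtype, inf_eq_left.2 hA]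
  have hle : ∀ {A B : Subgroup G}, A ≤ S → (A.subgroupOf S ≤ B.subgroupOf S ↔ A ≤ B) :=
    fun {A B} hA => ⟨fun h x hx => h (x := ⟨x, hA hx⟩) hx, fun h => comap_mono h⟩
  obtain ⟨M, h1, h2, h3⟩ := exists_covBy_inf_normal (S := S) hS (P := P.subgroupOf S)
    (X := X.subgroupOf S) (M₀ := M₀.subgroupOf S)
    ((normal_subgroupOf_iff_le_normalizer hPS).2 hSP) inferInstance ((hle (hXP.trans hPS)).2 hXP)
    (by
      rw [← map_subtype_covBy_iff, key _ hPS, key _ (hM₀.lt.le.trans hPS)]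
      exact hM₀)
    (fun h => hXM₀ ((hle (hXP.trans hPS)).1 h))
  refine ⟨M.map S.subtype, ?_, fun h => ?_, ?_⟩
  · rw [← key P hPS]
    exact map_subtype_covBy_iff.2 h1
  · refine h2 fun x hx => ?_
    obtain ⟨y, hy, hyx⟩ := h hx
    have h4 : y = x := Subtype.ext hyx
    exact h4 ▸ hy
  · rw [← normal_subgroupOf_iff_le_normalizer (inf_le_left.trans (map_subtype_le M))]
    convert h3
    rw [subgroupOf, comap_inf, comap_map_eq_self_of_injective S.subtype_injective]
    rfl

/-! ### Minimal normal subgroups under the `IC`-`Π`-property. -/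

lemma _root_.IsChiefFactor.eq_of_ne_bot {X : Subgroup G} (hX : IsChiefFactor ⊥ X) {A : Subgroup G}
    (hA : A.Normal) (hAX : A ≤ X) (h : A ≠ ⊥) : A = X :=
  (hX.eq_or_eq A hA bot_le hAX).resolve_left h

lemma commute_of_isChiefFactor_bot [Finite G] {p : ℕ} [Fact p.Prime] {X : Subgroup G}
    (hX : IsChiefFactor ⊥ X) (hXp : IsPGroup p X) : X ≤ centralizer (X : Set G) := by
  have := hX.normal_top
  have hnt : Nontrivial X := (nontrivial_iff_ne_bot X).2 hX.lt.ne'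
  have := hXp.center_nontrivial
  obtain ⟨z, hz⟩ := exists_ne (1 : center X)
  have h1 : X ⊓ centralizer (X : Set G) ≠ ⊥ := fun h => by
    have h2 : ((z : X) : G) ∈ X ⊓ centralizer (X : Set G) := by
      refine mem_inf.2 ⟨z.1.2, mem_centralizer_iff.2 fun y hy => ?_⟩
      exact congrArg Subtype.val (mem_center_iff.1 z.2 ⟨y, hy⟩)
    rw [h, mem_bot] at h2
    exact hz (Subtype.ext (Subtype.ext h2))
  rw [← hX.eq_of_ne_bot inferInstance inf_le_left h1]
  exact inf_le_right.trans (centralizer_le inf_le_left)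

/-- The solutions of `x ^ p = 1` in the abelian group `X` form a subgroup normal in `G`, nontrivial
by Cauchy, so it is all of `X`. -/
lemma pow_eq_one_of_isChiefFactor_bot [Finite G] {p : ℕ} [hp : Fact p.Prime] {X : Subgroup G}
    (hX : IsChiefFactor ⊥ X) (hc : X ≤ centralizer (X : Set G)) (hpX : p ∣ Nat.card X) {x : G}
    (hx : x ∈ X) : x ^ p = 1 := by
  let A : Subgroup G :=
    { carrier := {x | x ∈ X ∧ x ^ p = 1}
      one_mem' := ⟨one_mem X, one_pow p⟩
      mul_mem' := fun {a b} ha hb => ⟨mul_mem ha.1 hb.1, by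
        have : Commute a b := mem_centralizer_iff.1 (hc hb.1) a ha.1
        rw [this.mul_pow, ha.2, hb.2, one_mul]⟩
      inv_mem' := fun {a} ha => ⟨inv_mem ha.1, by rw [inv_pow, ha.2, inv_one]⟩ }
  have hA : A.Normal := ⟨fun n hn g => ⟨hX.normal_top.conj_mem n hn.1 g, by
    rw [conj_pow, hn.2]; group⟩⟩
  have hne : A ≠ ⊥ := by
    intro h
    obtain ⟨z, hz⟩ := exists_prime_orderOf_dvd_card' p hpX
    have h1 : (z : G) ∈ A := ⟨z.2, by
      rw [← SubmonoidClass.coe_pow, ← hz, pow_orderOf_eq_one]; rfl⟩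
    rw [h, mem_bot] at h1
    rw [show z = 1 from Subtype.ext h1, orderOf_one] at hz
    exact hp.out.one_lt.ne hz
  rw [← hX.eq_of_ne_bot hA (fun x hx => hx.1) hne] at hx
  exact hx.2

lemma dvd_card_of_isPGroup [Finite G] {p : ℕ} [Fact p.Prime] {X : Subgroup G}
    (hXp : IsPGroup p X) (h : X ≠ ⊥) : p ∣ Nat.card X :=
  hXp.card_eq_or_dvd.resolve_left fun h1 => h (Subgroup.card_eq_one.1 h1)

/-- If `M ∩ X ≠ 1` for a `p`-subgroup `M` with the `IC`-`Π`-property and a minimal normal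
subgroup `X`, then `X` is a `p`-group contained in `M` or in `[M, G]`. -/
lemma isPGroup_of_inf_ne_bot [Finite G] {p : ℕ} [Fact p.Prime] {M X : Subgroup G}
    (hM : IsPGroup p M) (hπ : PrimePowerPi p (M ⊓ ⁅M, (⊤ : Subgroup G)⁆))
    (hX : IsChiefFactor ⊥ X) (h : M ⊓ X ≠ ⊥) :
    IsPGroup p X ∧ (X ≤ M ∨ X ≤ ⁅M, (⊤ : Subgroup G)⁆) := by
  have := hX.normal_top
  by_cases hD : ⁅M, (⊤ : Subgroup G)⁆ ⊓ X = ⊥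
  -- Here `[M ∩ X, G] ≤ [M, G] ∩ X = 1`, so `M ∩ X` is central, therefore normal, therefore equal to
  -- `X`.
  · have hcen : M ⊓ X ≤ center G := by
      intro m hm
      obtain ⟨hmM, hmX⟩ := mem_inf.1 hm
      refine mem_center_iff.2 fun g => ?_
      have h1 : ⁅m, g⁆ ∈ ⁅M, (⊤ : Subgroup G)⁆ ⊓ X :=
        mem_inf.2 ⟨commutator_mem_commutator hmM (mem_top g),
          commutator_le_left X ⊤ (commutator_mem_commutator hmX (mem_top g))⟩
      rw [hD, mem_bot, commutatorElement_eq_one_iff_mul_comm] at h1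
      exact h1.symm
    have hn : (M ⊓ X).Normal := ⟨fun n hn g => by
      rw [mem_center_iff.1 (hcen hn) g, mul_inv_cancel_right]; exact hn⟩
    have h1 := hX.eq_of_ne_bot hn inf_le_right h
    have h2 : X ≤ M := h1 ▸ inf_le_left
    exact ⟨hM.to_le h2, Or.inl h2⟩
  · have h1 := hX.eq_of_ne_bot inferInstance inf_le_right hD
    have h2 : X ≤ ⁅M, (⊤ : Subgroup G)⁆ := h1 ▸ inf_le_left
    have h3 : M ⊓ ⁅M, (⊤ : Subgroup G)⁆ ⊓ X = M ⊓ X := by rw [inf_assoc, inf_eq_right.2 h2]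
    obtain ⟨m, hm⟩ := hπ.relIndex_eq_pow (hM.to_le inf_le_left) hX
      (fun h4 => h (h3 ▸ le_bot_iff.1 h4))
    exact ⟨isPGroup_of_relIndex bot_le IsPGroup.of_bot hm, Or.inr h2⟩

/-- Some maximal subgroup of `P` meets `X` nontrivially: any one if `P ≤ X`, since `|P| ≠ p` makes
it nontrivial, and otherwise one containing `P ∩ X`. -/
lemma MaximalICPi.isPGroup_of_isChiefFactor [Finite G] {p : ℕ} [hp : Fact p.Prime]
    {P N X : Subgroup G} (hP : SylowIn p P N) (h : MaximalICPi p P) (hX : IsChiefFactor ⊥ X)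
    (hXN : X ≤ N) (hpX : p ∣ Nat.card X) (hcard : Nat.card P ≠ p) : IsPGroup p X := by
  have hPX := hP.not_inf_le (K := ⊥) hX.normal_top hXN (by rwa [relIndex_bot_left])
  have hPX' : P ⊓ X ≠ ⊥ := fun h0 => hPX h0.le
  by_cases hle : P ≤ X
  · have hPbot : ⊥ < P := bot_lt_iff_ne_bot.2 fun h0 => hPX (inf_le_left.trans h0.le)
    obtain ⟨M, -, hM⟩ := exists_le_covBy_of_lt hPbot
    refine (isPGroup_of_inf_ne_bot (hP.isPGroup.to_le hM.lt.le) (h M hM) hX fun h0 => ?_).1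
    rw [inf_eq_left.2 (hM.lt.le.trans hle)] at h0
    have h1 := (relIndex_eq_of_covBy hP.isPGroup hM).2
    rw [h0, relIndex_bot_left] at h1
    exact hcard h1
  · obtain ⟨M, hXM, hM⟩ := exists_le_covBy_of_lt (lt_of_le_of_ne (inf_le_left (a := P) (b := X))
      fun h0 => hle (h0 ▸ inf_le_right))
    exact (isPGroup_of_inf_ne_bot (hP.isPGroup.to_le hM.lt.le) (h M hM) hX fun h0 =>
      hPX' (le_bot_iff.1 (h0 ▸ le_inf hXM inf_le_right))).1

/-- Choose `M` so that a Sylow `p`-subgroup `S ≥ P` of `G` normalizes `M ∩ X`. If `M ∩ X = 1`, then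
`|X| = |P : M| = p`. Otherwise `X ≤ [M, G]`, so the `Π`-property applies to `M ∩ X` itself and makes
it normal in `G`; then `X ≤ M`, a contradiction. -/
lemma MaximalICPi.card_eq_of_not_le [Finite G] {p : ℕ} [hp : Fact p.Prime]
    {P N X M₀ : Subgroup G} (hN : N.Normal) (hP : SylowIn p P N) (h : MaximalICPi p P)
    (hX : IsChiefFactor ⊥ X) (hXp : IsPGroup p X) (hXN : X ≤ N) (hM₀ : M₀ ⋖ P)
    (hXM₀ : ¬ X ≤ M₀) : Nat.card X = p := by
  have hXP := hP.le_of_normal hX.normal_top hXp hXN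
  obtain ⟨S, hPS⟩ := hP.isPGroup.exists_le_sylow
  have hSN : (S : Subgroup G) ⊓ N = P :=
    hP.eq_of_le (S.2.to_le inf_le_left) inf_le_right (le_inf hPS hP.le)
  have hSP : (S : Subgroup G) ≤ normalizer (P : Set G) := by
    refine le_normalizer_iff.2 fun s hs x hx => ?_
    rw [← hSN] at hx ⊢
    exact mem_inf.2 ⟨mul_mem (mul_mem hs (mem_inf.1 hx).1) (inv_mem hs),
      hN.conj_mem x (mem_inf.1 hx).2 s⟩
  obtain ⟨M, hM, hXM, hSM⟩ :=
    exists_covBy_le_normalizer_inf S.2 hPS hSP hX.normal_top hXP hM₀ hXM₀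
  have := hX.normal_top
  by_cases h0 : M ⊓ X = ⊥
  · have h1 : M ⊔ X = P := by
      by_contra h2
      refine hM.2 (lt_of_le_of_ne le_sup_left fun h3 => hXM (h3 ▸ le_sup_right))
        (lt_of_le_of_ne (sup_le hM.lt.le hXP) h2)
    have h2 := (relIndex_eq_of_covBy hP.isPGroup hM).2
    rwa [← h1, relIndex_sup_self_of_normal hX.normal_top, ← inf_relIndex_right, h0,
      relIndex_bot_left] at h2
  · obtain ⟨-, h1⟩ := isPGroup_of_inf_ne_bot (hP.isPGroup.to_le hM.lt.le) (h M hM) hX h0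
    have h2 := h1.resolve_left hXM
    obtain ⟨n, hn⟩ := h M hM ⊥ X hX
    rw [inf_assoc, inf_eq_right.2 h2, sup_bot_eq] at hn
    have h3 := normal_of_sylow_le_normalizer S.not_dvd_index hn hSM
    exact absurd (hX.eq_of_ne_bot h3 inf_le_right h0 ▸ inf_le_left) hXM

/-! ### Transfer and the case `|P : X| = p`. -/

/-- The transfer into the abelian Sylow subgroup `P` kills commutators and sends a central `x` to `x
^ |T : P|`, an exponent prime to the order of `x`. -/
lemma eq_one_of_mem_center_of_mem_commutator {T : Type*} [Group T] [Finite T] {p : ℕ}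
    [hp : Fact p.Prime] {P : Subgroup T} (hP : IsPGroup p P) (hPi : ¬ p ∣ P.index)
    (hcomm : P ≤ centralizer (P : Set T)) {x : T} (hxP : x ∈ P) (hx : x ∈ center T)
    (hxc : x ∈ commutator T) : x = 1 := by
  let _ : CommGroup P :=
    { (inferInstance : Group P) with
      mul_comm := fun a b => Subtype.ext (mem_centralizer_iff.1 (hcomm b.2) a a.2) }
  have h1 : (MonoidHom.id P).transfer x = 1 := by
    have h2 := Abelianization.commutator_subset_ker ((MonoidHom.id P).transfer) hxc
    exact h2
  have h3 := MonoidHom.transfer_eq_pow (MonoidHom.id P) x (fun k g₀ _ => by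
    have := mem_center_iff.1 (pow_mem hx k) g₀
    rw [mul_assoc, ← this, inv_mul_cancel_left])
  rw [h1] at h3
  have h4 : x ^ P.index = 1 := (congrArg Subtype.val h3).symm
  obtain ⟨k, hk⟩ := hP ⟨x, hxP⟩
  have h5 : x ^ p ^ k = 1 := congrArg Subtype.val hk
  have h6 : Nat.Coprime (p ^ k) P.index :=
    Nat.Coprime.pow_left _ ((Nat.Prime.coprime_iff_not_dvd Fact.out).2 hPi)
  exact orderOf_eq_one_iff.1 (Nat.eq_one_of_dvd_coprimes h6 (orderOf_dvd_of_pow_eq_one h5)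
    (orderOf_dvd_of_pow_eq_one h4))

lemma eq_one_of_mem_centralizer_of_mem_commutator [Finite G] {p : ℕ} [hp : Fact p.Prime]
    {P C : Subgroup G} (hP : SylowIn p P C) (hcomm : P ≤ centralizer (P : Set G)) {x : G}
    (hxP : x ∈ P) (hx : x ∈ centralizer (C : Set G)) (hxc : x ∈ ⁅C, C⁆) : x = 1 := by
  rw [← map_subtype_commutator] at hxc
  obtain ⟨y, hy, rfl⟩ := hxc
  have := eq_one_of_mem_center_of_mem_commutator (T := C) (P := P.subgroupOf C) (x := y) (p := p)
    hP.isPGroup.comap_subtype hP.not_dvd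
    (fun a ha => mem_centralizer_iff.2 fun b hb =>
      Subtype.ext (mem_centralizer_iff.1 (hcomm ha) b hb))
    hxP (mem_center_iff.2 fun g => Subtype.ext (mem_centralizer_iff.1 hx g g.2)) hy
  rw [this]; rfl

lemma isPGroup_of_abelian_isChiefFactor_bot [Finite G] {p : ℕ} [hp : Fact p.Prime] {X : Subgroup G}
    (hX : IsChiefFactor ⊥ X) (hc : X ≤ centralizer (X : Set G)) (hpX : p ∣ Nat.card X) :
    IsPGroup p X := fun x =>
  ⟨1, Subtype.ext (by simpa using pow_eq_one_of_isChiefFactor_bot hX hc hpX x.2)⟩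

lemma relIndex_eq_pow_of_commutator_le [Finite G] {p : ℕ} [hp : Fact p.Prime] {K L : Subgroup G}
    (h : IsChiefFactor K L) (hc : ⁅L, L⁆ ≤ K) (hpL : p ∣ K.relIndex L) :
    ∃ m, K.relIndex L = p ^ m := by
  have := h.normal_bot
  have hs := QuotientGroup.mk'_surjective K
  have h1 := isChiefFactor_map hs (by rw [QuotientGroup.ker_mk']) h
  have hK : K.map (QuotientGroup.mk' K) = ⊥ := by
    rw [Subgroup.map_eq_bot_iff, QuotientGroup.ker_mk']
  rw [hK] at h1
  have h2 : Nat.card (L.map (QuotientGroup.mk' K)) = K.relIndex L := by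
    rw [← relIndex_ker, QuotientGroup.ker_mk']
  have h3 : L.map (QuotientGroup.mk' K) ≤ centralizer (L.map (QuotientGroup.mk' K) : Set (G ⧸ K)) := by
    rw [← commutator_eq_bot_iff_le_centralizer, ← map_commutator, eq_bot_iff, ← hK]
    exact map_mono hc
  rw [← h2]
  exact IsPGroup.iff_card.1 (isPGroup_of_abelian_isChiefFactor_bot h1 h3 (h2 ▸ hpL))

/-- `G` acts on `X` through `Aut X`, which is abelian because `X` is cyclic. -/
lemma commutator_le_centralizer_of_card_eq_prime [Finite G] {p : ℕ} [hp : Fact p.Prime]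
    {X : Subgroup G} (hX : X.Normal) (hcard : Nat.card X = p) (L : Subgroup G) :
    ⁅L, L⁆ ≤ centralizer (X : Set G) := by
  have h1 : IsCyclic X := isCyclic_of_prime_card hcard
  have h2 : ⁅(⊤ : Subgroup G), (⊤ : Subgroup G)⁆ ≤ (MulAut.conjNormal (H := X)).ker := by
    rw [commutator_le]
    intro a _ b _
    rw [MonoidHom.mem_ker, map_commutatorElement, commutatorElement_eq_one_iff_mul_comm]
    exact (IsCyclic.mulAutMulEquiv X).injective (by rw [map_mul, map_mul, mul_comm])
  refine ((commutator_mono le_top le_top).trans h2).trans fun g hg => ?_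
  refine mem_centralizer_iff.2 fun x hx => ?_
  have h4 := congrArg (fun f : MulAut X => ((f ⟨x, hx⟩ : X) : G)) hg
  simp only [MulAut.conjNormal_apply, MulAut.one_apply] at h4
  exact (mul_inv_eq_iff_eq_mul.1 h4).symm

lemma exists_zpowers_eq_of_unique_covBy [Finite G] {P X : Subgroup G} (hXP : X < P)
    (h : ∀ M, M ⋖ P → M = X) : ∃ z, zpowers z = P := by
  obtain ⟨z, hzP, hzX⟩ := SetLike.exists_of_lt hXP
  refine ⟨z, ?_⟩
  by_contra hne
  obtain ⟨M, hzM, hM⟩ := exists_le_covBy_of_lt (lt_of_le_of_ne (zpowers_le.2 hzP) hne)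
  exact hzX (h M hM ▸ hzM (mem_zpowers z))

lemma le_of_unique_covBy [Finite G] {P X A : Subgroup G} (h : ∀ M, M ⋖ P → M = X) (hA : A < P) :
    A ≤ X := by
  obtain ⟨M, hAM, hM⟩ := exists_le_covBy_of_lt hA
  exact h M hM ▸ hAM

lemma card_eq_of_le_zpowers [Finite G] {p : ℕ} [hp : Fact p.Prime] {X : Subgroup G} {z : G}
    (hX : IsChiefFactor ⊥ X) (hXp : IsPGroup p X) (hz : X ≤ zpowers z) : Nat.card X = p := by
  have h1 : IsCyclic X := isCyclic_of_injective (inclusion hz) (inclusion_injective hz)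
  have h2 : Nat.card X ∣ p := by
    rw [← IsCyclic.exponent_eq_card]
    exact Monoid.exponent_dvd_of_forall_pow_eq_one fun x => Subtype.ext
      (pow_eq_one_of_isChiefFactor_bot hX (commute_of_isChiefFactor_bot hX hXp)
        (dvd_card_of_isPGroup hXp hX.lt.ne') x.2)
  exact ((Nat.dvd_prime hp.out).1 h2).resolve_left fun h => hX.lt.ne' (Subgroup.card_eq_one.1 h)

lemma eq_of_covBy_of_le [Finite G] {M X P : Subgroup G} (hM : M ⋖ P) (hX : X ⋖ P) (h : M ≤ X) :
    M = X := by
  by_contra hne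
  exact hM.2 (lt_of_le_of_ne h hne) hX.lt

section PrimeQuotient

variable [Finite G] {p : ℕ} [hp : Fact p.Prime] {P N X : Subgroup G}

lemma MaximalICPi.card_eq_of_relIndex_eq (hN : N.Normal) (hP : SylowIn p P N)
    (h : MaximalICPi p P) (hX : IsChiefFactor ⊥ X) (hXp : IsPGroup p X) (hXN : X ≤ N)
    (hXP : X ⋖ P) : Nat.card X = p := by
  by_cases hM : ∃ M, M ⋖ P ∧ ¬ X ≤ M
  · obtain ⟨M, hM, hXM⟩ := hM
    exact h.card_eq_of_not_le hN hP hX hXp hXN hM hXM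
  -- Now `X` is the only maximal subgroup of `P`, so `P` is cyclic; `X` is then cyclic of exponent
  -- `p`.
  · push Not at hM
    obtain ⟨z, hz⟩ := exists_zpowers_eq_of_unique_covBy hXP.lt fun M hM' =>
      (eq_of_covBy_of_le hXP hM' (hM M hM')).symm
    exact card_eq_of_le_zpowers hX hXp (hz ▸ hXP.lt.le)

variable {K L : Subgroup G}

/-- As `L/K` is not a `p`-group, `M ∩ [M, G]` must avoid it. On the other hand `[M, G] ≤ K` would
make `MK` normal and `L/K = MK/K` a `p`-group; so `[M, G]K = L`, and the Sylow subgroup `P ∩ [M, G]`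
of `[M, G]` cannot lie in `K`. -/
lemma inf_commutator_le_and_not_le (hP : SylowIn p P N) (h : MaximalICPi p P)
    (hXP : X ⋖ P) (hKL : IsChiefFactor K L) (hLN : L ≤ N) (hpL : p ∣ K.relIndex L)
    (hPL : P ≤ L) (hPK : P ⊓ K = X) (hnp : ∀ m, K.relIndex L ≠ p ^ m) {M : Subgroup G}
    (hM : M ⋖ P) (hMX : M ≠ X) :
    M ⊓ ⁅M, (⊤ : Subgroup G)⁆ ≤ X ∧ ¬ P ⊓ ⁅M, (⊤ : Subgroup G)⁆ ≤ X := by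
  have := hKL.normal_bot
  have := hKL.normal_top
  have hMp : IsPGroup p M := hP.isPGroup.to_le hM.lt.le
  have hML : M ≤ L := hM.lt.le.trans hPL
  have hXK : X ≤ K := hPK ▸ inf_le_right
  have hMK : ¬ M ≤ K := fun h1 =>
    hMX (eq_of_covBy_of_le hM hXP (hPK ▸ le_inf hM.lt.le h1))
  constructor
  · by_contra hc
    obtain ⟨m, hm⟩ := (h M hM).relIndex_eq_pow (hMp.to_le inf_le_left) hKL (fun h1 => hc (by
      rw [inf_eq_left.2 (inf_le_left.trans hML)] at h1
      exact hPK ▸ le_inf (inf_le_left.trans hM.lt.le) h1))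
    exact hnp m hm
  · set D := ⁅M, (⊤ : Subgroup G)⁆ with hD
    have hDn : D.Normal := commutator_top_normal M
    have hDL : D ≤ L := (commutator_mono hML le_rfl).trans (commutator_le_left L ⊤)
    have hDK : ¬ D ≤ K := by
      intro hDK
      have hn : (M ⊔ K).Normal := by
        refine ⟨fun n hn g => ?_⟩
        obtain ⟨m, hm, k, hk, rfl⟩ := mem_sup_of_normal_right.1 hn
        have h1 : g * (m * k) * g⁻¹ = ⁅m, g⁆⁻¹ * m * (g * k * g⁻¹) := by
          simp only [commutatorElement_def]; group
        rw [h1]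
        have hKs : K ≤ M ⊔ K := le_sup_right
        exact mul_mem (mul_mem (hKs (hDK (inv_mem (commutator_mem_commutator hm (mem_top g)))))
          (le_sup_left (a := M) hm)) (hKs (hKL.normal_bot.conj_mem k hk g))
      rcases hKL.eq_or_eq _ hn le_sup_right (sup_le hML hKL.lt.le) with h1 | h1
      · exact hMK (h1 ▸ le_sup_left)
      · obtain ⟨m, hm⟩ := exists_relIndex_eq_pow hMp K
        refine hnp m ?_
        rw [← h1, relIndex_sup_right, hm]
    have h2 : D ⊔ K = L := (hKL.eq_or_eq (D ⊔ K) inferInstance le_sup_right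
      (sup_le hDL hKL.lt.le)).resolve_left fun h3 => hDK (h3 ▸ le_sup_left)
    have h3 : p ∣ K.relIndex D := by rwa [← relIndex_sup_right, h2]
    exact fun h4 => hP.not_inf_le hDn (hDL.trans hLN) h3 (h4.trans hXK)

/-- Here `|P| = p²`, and `M₁ = P ∩ [M, G]` is a subgroup of order `p` different from `X`. The same
dichotomy for `M₁` is contradictory: `P ∩ [M₁, G] ≤ P ∩ [M, G] = M₁` gives `P ∩ [M₁, G] ≤ M₁ ∩ [M₁,
G] ≤ X`. -/
lemma false_of_exists_covBy_ne (hP : SylowIn p P N) (h : MaximalICPi p P) (hXcard : Nat.card X = p)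
    (hXP : X ⋖ P) (hKL : IsChiefFactor K L) (hLN : L ≤ N) (hpL : p ∣ K.relIndex L)
    (hPL : P ≤ L) (hPK : P ⊓ K = X) (hnp : ∀ m, K.relIndex L ≠ p ^ m) {M : Subgroup G}
    (hM : M ⋖ P) (hMX : M ≠ X) : False := by
  have key : ∀ {M : Subgroup G}, M ⋖ P → M ≠ X →
      M ⊓ ⁅M, (⊤ : Subgroup G)⁆ ≤ X ∧ ¬ P ⊓ ⁅M, (⊤ : Subgroup G)⁆ ≤ X := fun hM hMX =>
    inf_commutator_le_and_not_le hP h hXP hKL hLN hpL hPL hPK hnp hM hMX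
  obtain ⟨h1, h2⟩ := key hM hMX
  have hlt : P ⊓ ⁅M, (⊤ : Subgroup G)⁆ < P := by
    refine lt_of_le_of_ne inf_le_left fun h3 => hMX (eq_of_covBy_of_le hM hXP ?_)
    rwa [inf_eq_left.2 (hM.lt.le.trans (inf_eq_left.1 h3))] at h1
  obtain ⟨M₁, hM₁, hM₁P⟩ := exists_le_covBy_of_lt hlt
  have hM₁X : M₁ ≠ X := fun h3 => h2 (h3 ▸ hM₁)
  have hPcard : ∀ {A : Subgroup G}, A ⋖ P → Nat.card A * p = Nat.card P := fun {A} hA => by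
    have h4 := relIndex_mul_relIndex ⊥ A P bot_le hA.lt.le
    rwa [relIndex_bot_left, relIndex_bot_left, (relIndex_eq_of_covBy hP.isPGroup hA).2] at h4
  have hcardM₁ : Nat.card M₁ = p := by
    have h4 := (hPcard hM₁P).trans (hPcard hXP).symm
    rw [hXcard] at h4
    exact Nat.eq_of_mul_eq_mul_right hp.out.pos h4
  have hne : P ⊓ ⁅M, (⊤ : Subgroup G)⁆ ≠ ⊥ := fun h3 => h2 (h3 ▸ bot_le)
  have hMeq : P ⊓ ⁅M, (⊤ : Subgroup G)⁆ = M₁ := by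
    refine eq_of_le_of_card_ge hM₁ ?_
    rw [hcardM₁]
    exact Nat.le_of_dvd Nat.card_pos
      (dvd_card_of_isPGroup (hP.isPGroup.to_le inf_le_left) hne)
  obtain ⟨h5, h6⟩ := key hM₁P hM₁X
  have h7 : ⁅M₁, (⊤ : Subgroup G)⁆ ≤ ⁅M, (⊤ : Subgroup G)⁆ :=
    (commutator_mono (hMeq.symm.le.trans inf_le_right) le_rfl).trans (commutator_le_left _ ⊤)
  exact h6 ((le_inf ((inf_le_inf_left P h7).trans hMeq.le) inf_le_right).trans h5)

/-- `P` is cyclic. For `C = C_L(X)` one has `L = CK` and `P ≤ C`, and transfer gives `X ∩ [C, C] =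
1`. Every nontrivial subgroup of `P` meets `X`, so `[C, C]` is a normal `p'`-subgroup, hence
trivial, and `L/K` is abelian. An abelian chief factor of order divisible by `p` is a `p`-group. -/
lemma false_of_unique_covBy (hP : SylowIn p P N) (hXcard : Nat.card X = p) (hXn : X.Normal)
    (hO : ∀ Y : Subgroup G, Y.Normal → Y ≤ N → ¬ p ∣ Nat.card Y → Y = ⊥)
    (hXP : X ⋖ P) (hKL : IsChiefFactor K L) (hLN : L ≤ N) (hpL : p ∣ K.relIndex L)
    (hPK : P ⊓ K = X) (hnp : ∀ m, K.relIndex L ≠ p ^ m)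
    (hM : ∀ M, M ⋖ P → M = X) : False := by
  have := hKL.normal_bot
  have := hKL.normal_top
  obtain ⟨z, hz⟩ := exists_zpowers_eq_of_unique_covBy hXP.lt hM
  have hPcomm : P ≤ centralizer (P : Set G) := by
    rw [← hz]
    exact le_centralizer _
  have hab : ¬ ⁅L, L⁆ ≤ K := fun h1 => by
    obtain ⟨m, hm⟩ := relIndex_eq_pow_of_commutator_le hKL h1 hpL
    exact hnp m hm
  set C := L ⊓ centralizer (X : Set G) with hC
  have hCn : C.Normal := inferInstance
  have hLC : ⁅L, L⁆ ≤ C := le_inf (commutator_le_left L L)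
    (commutator_le_centralizer_of_card_eq_prime hXn hXcard L)
  have hCK : C ⊔ K = L := (hKL.eq_or_eq (C ⊔ K) inferInstance le_sup_right
    (sup_le inf_le_left hKL.lt.le)).resolve_left fun h3 => hab (hLC.trans (h3 ▸ le_sup_left))
  have hpC : p ∣ K.relIndex C := by rwa [← relIndex_sup_right, hCK]
  have hPC : P ≤ C := by
    by_contra hc
    have h1 : P ⊓ C < P := lt_of_le_of_ne inf_le_left fun h2 => hc (inf_eq_left.1 h2)
    refine hP.not_inf_le hCn (inf_le_left.trans hLN) hpC ((le_of_unique_covBy hM h1).trans ?_)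
    rw [← hPK]; exact inf_le_right
  have hCS : SylowIn p P C := by
    have := hP.inf_normal hCn (inf_le_left.trans hLN)
    rwa [inf_eq_left.2 hPC] at this
  have hXC : ∀ x ∈ X, x ∈ ⁅C, C⁆ → x = 1 := fun x hx hxc =>
    eq_one_of_mem_centralizer_of_mem_commutator hCS hPcomm (hXP.lt.le hx)
      (mem_centralizer_iff.2 fun c hc => (mem_centralizer_iff.1 (mem_inf.1 hc).2 x hx).symm) hxc
  have hXne : X ≠ ⊥ := fun h1 => by
    rw [h1, card_bot] at hXcard
    exact hp.out.one_lt.ne hXcard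
  have hPX : P ⊓ ⁅C, C⁆ ≤ X := by
    refine le_of_unique_covBy hM (lt_of_le_of_ne inf_le_left fun h1 => hXne ?_)
    exact (eq_bot_iff_forall X).2 fun x hx => hXC x hx (inf_eq_left.1 h1 (hXP.lt.le hx))
  have hPbot : P ⊓ ⁅C, C⁆ = ⊥ := (eq_bot_iff_forall _).2 fun x hx =>
    hXC x (hPX hx) (mem_inf.1 hx).2
  have hCC : ⁅C, C⁆ ≤ N := (commutator_le_left C C).trans (inf_le_left.trans hLN)
  have h1 := (hP.inf_normal (commutator_normal C C) hCC).not_dvd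
  rw [hPbot, relIndex_bot_left] at h1
  have h2 := hO _ (commutator_normal C C) hCC h1
  refine hab ?_
  have h3 : ⁅L, L⁆.map (QuotientGroup.mk' K) = ⊥ := by
    have h4 : K.map (QuotientGroup.mk' K) = ⊥ := by
      rw [Subgroup.map_eq_bot_iff, QuotientGroup.ker_mk']
    rw [map_commutator, ← hCK, Subgroup.map_sup, h4, sup_bot_eq, ← map_commutator, h2, Subgroup.map_bot]
  rwa [Subgroup.map_eq_bot_iff, QuotientGroup.ker_mk'] at h3

lemma MaximalICPi.cyclicBetween_of_relIndex_eq (hN : N.Normal) (hP : SylowIn p P N)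
    (h : MaximalICPi p P) (hX : IsChiefFactor ⊥ X) (hXp : IsPGroup p X) (hXN : X ≤ N)
    (hXP : X ⋖ P) (hO : ∀ Y : Subgroup G, Y.Normal → Y ≤ N → ¬ p ∣ Nat.card Y → Y = ⊥) :
    CyclicBetween p X N := by
  have hXcard := h.card_eq_of_relIndex_eq hN hP hX hXp hXN hXP
  intro K L hKL hXK hLN hpL
  have hPLK := hP.not_inf_le hKL.normal_top hLN hpL
  have hPL : P ≤ L := by
    by_contra hc
    have h1 : P ⊓ L < P := lt_of_le_of_ne inf_le_left fun h2 => hc (inf_eq_left.1 h2)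
    have h2 : X ≤ P ⊓ L := le_inf hXP.lt.le (hXK.trans hKL.lt.le)
    rcases h2.eq_or_lt with h3 | h3
    · exact hPLK (h3 ▸ hXK)
    · exact hXP.2 h3 h1
  have hPK : P ⊓ K = X := by
    have h2 : X ≤ P ⊓ K := le_inf hXP.lt.le hXK
    by_contra hc
    refine hXP.2 (lt_of_le_of_ne h2 (Ne.symm hc)) (lt_of_le_of_ne inf_le_left fun h3 => ?_)
    exact hPLK (inf_le_left.trans (inf_eq_left.1 h3))
  have hpow : ∃ m, K.relIndex L = p ^ m := by
    by_contra hc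
    push Not at hc
    by_cases hM : ∃ M, M ⋖ P ∧ M ≠ X
    · obtain ⟨M, hM, hMX⟩ := hM
      exact false_of_exists_covBy_ne hP h hXcard hXP hKL hLN hpL hPL hPK hc hM hMX
    · push Not at hM
      exact false_of_unique_covBy hP hXcard hX.normal_top hO hXP hKL hLN hpL hPK hc hM
  obtain ⟨m, hm⟩ := hpow
  have hPLi : ¬ p ∣ P.relIndex L := by
    have := (hP.inf_normal hKL.normal_top hLN).not_dvd
    rwa [inf_eq_left.2 hPL] at this
  have h1 := relIndex_mul_relIndex X P L hXP.lt.le hPL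
  have h2 := relIndex_mul_relIndex X K L hXK hKL.lt.le
  rw [(relIndex_eq_of_covBy hP.isPGroup hXP).2] at h1
  -- `|L : X| = p · |L : P|` with `|L : P|` prime to `p`, so the `p`-power `|L : K|` divides `p`.
  have h3 : K.relIndex L ∣ p * P.relIndex L := by rw [h1, ← h2]; exact Dvd.intro_left _ rfl
  have h4 : Nat.Coprime (K.relIndex L) (P.relIndex L) := by
    rw [hm]
    exact Nat.Coprime.pow_left _ ((Nat.Prime.coprime_iff_not_dvd hp.out).2 hPLi)
  have h5 := h4.dvd_of_dvd_mul_right h3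
  exact Nat.dvd_antisymm h5 hpL

end PrimeQuotient

/-! ### Normal `p'`-sections above a minimal normal subgroup inside the Frattini subgroup. -/

lemma exists_normal_complement_of_central [Finite G] {p : ℕ} [hp : Fact p.Prime]
    {A C : Subgroup G} (hA : A.Normal) (hC : C.Normal) (hAC : A ≤ C) (hAp : IsPGroup p A)
    (hcen : A ≤ centralizer (C : Set G)) (hidx : ¬ p ∣ A.relIndex C) :
    ∃ T : Subgroup G, T.Normal ∧ T ≤ C ∧ ¬ p ∣ Nat.card T ∧ (T = ⊥ → C = A) := by
  set n := A.relIndex C with hn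
  -- The transfer into the center is `c ↦ c ^ |C : Z(C)|`, and `|C : Z(C)|` divides `n`; so `c ↦ c ^
  -- n` is an endomorphism of `C`. Its kernel is the required complement.
  have hmul : ∀ a b : C, (a * b) ^ n = a ^ n * b ^ n := by
    have h1 : A.subgroupOf C ≤ center C := fun a ha => mem_center_iff.2 fun g =>
      Subtype.ext (mem_centralizer_iff.1 (hcen ha) g g.2)
    obtain ⟨k, hk⟩ : (center C).index ∣ n := index_dvd_of_le h1
    intro a b
    have h2 : (a * b) ^ (center C).index = a ^ (center C).index * b ^ (center C).index := by
      have := congrArg (Subtype.val) (map_mul (MonoidHom.transferCenterPow C) a b)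
      exact this
    have h3 : Commute (a ^ (center C).index) (b ^ (center C).index) :=
      (mem_center_iff.1 ((center C).pow_index_mem b) _)
    rw [hk, pow_mul, h2, h3.mul_pow, ← pow_mul, ← pow_mul]
  let T : Subgroup G :=
    { carrier := {c | c ∈ C ∧ c ^ n = 1}
      one_mem' := ⟨one_mem C, one_pow n⟩
      mul_mem' := fun {a b} ha hb => ⟨mul_mem ha.1 hb.1, by
        have h1 : (a * b) ^ n = a ^ n * b ^ n :=
          congrArg Subtype.val (hmul ⟨a, ha.1⟩ ⟨b, hb.1⟩)
        rw [h1, ha.2, hb.2, one_mul]⟩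
      inv_mem' := fun {a} ha => ⟨inv_mem ha.1, by rw [inv_pow, ha.2, inv_one]⟩ }
  refine ⟨T, ⟨fun c hc g => ⟨hC.conj_mem c hc.1 g, by rw [conj_pow, hc.2]; group⟩⟩,
    fun c hc => hc.1, fun hpT => ?_, fun hT => ?_⟩
  · obtain ⟨z, hz⟩ := exists_prime_orderOf_dvd_card' p hpT
    apply hidx
    rw [← hz, orderOf_dvd_iff_pow_eq_one]
    exact Subtype.ext (by simpa using z.2.2)
  · have hCp : IsPGroup p C := by
      obtain ⟨k, hk⟩ := IsPGroup.iff_card.1 hAp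
      intro c
      refine ⟨k, Subtype.ext ?_⟩
      have h1 : (c : G) ^ n ∈ A := by
        have := (A.subgroupOf C).pow_index_mem c
        exact this
      have h2 : ((c : G) ^ n) ^ Nat.card A = 1 :=
        congrArg Subtype.val (pow_card_eq_one' (x := (⟨_, h1⟩ : A)))
      have h3 : (c : G) ^ p ^ k ∈ T := ⟨pow_mem c.2 _, by
        rw [← hk, ← pow_mul, mul_comm, pow_mul, h2]⟩
      rw [hT, mem_bot] at h3
      simpa using h3
    obtain ⟨m, hm⟩ := exists_relIndex_eq_pow hCp A
    have h0 : m = 0 := by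
      by_contra h0
      exact hidx (hn.trans hm ▸ dvd_pow_self p h0)
    rw [h0, pow_zero] at hm
    exact le_antisymm (relIndex_eq_one.1 hm) hAC

lemma exists_normal_complement_mod [Finite G] {p : ℕ} [hp : Fact p.Prime]
    {X A C : Subgroup G} (hX : X.Normal) (hA : A.Normal) (hC : C.Normal) (hXA : X ≤ A)
    (hAC : A ≤ C) (hAp : IsPGroup p A) (hcen : ⁅A, C⁆ ≤ X) (hidx : ¬ p ∣ A.relIndex C) :
    ∃ T : Subgroup G, T.Normal ∧ X ≤ T ∧ T ≤ C ∧ ¬ p ∣ X.relIndex T ∧ (T = X → C = A) := by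
  have hs := QuotientGroup.mk'_surjective X
  have hker : (QuotientGroup.mk' X).ker = X := QuotientGroup.ker_mk' X
  have hXbot : X.map (QuotientGroup.mk' X) = ⊥ := by rw [Subgroup.map_eq_bot_iff, hker]
  have hcomap : ∀ {B : Subgroup G}, X ≤ B →
      (B.map (QuotientGroup.mk' X)).comap (QuotientGroup.mk' X) = B :=
    fun {B} hB => comap_map_eq_self (by rwa [hker])
  obtain ⟨T, hT, hTC, hTp, h⟩ := exists_normal_complement_of_central (p := p)
    (hA.map (QuotientGroup.mk' X) hs) (hC.map (QuotientGroup.mk' X) hs) (map_mono hAC)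
    (hAp.map _)
    (by
      rw [← commutator_eq_bot_iff_le_centralizer, ← map_commutator, eq_bot_iff, ← hXbot]
      exact map_mono hcen)
    (by rwa [relIndex_map_map, hker, sup_eq_left.2 hXA, sup_eq_left.2 (hXA.trans hAC)])
  have hXT : X ≤ T.comap (QuotientGroup.mk' X) := by
    have := (QuotientGroup.mk' X).ker_le_comap T
    rwa [hker] at this
  refine ⟨T.comap (QuotientGroup.mk' X), hT.comap _, hXT, ?_, ?_, fun hTX => ?_⟩
  · exact (comap_mono hTC).trans (hcomap (hXA.trans hAC)).le
  · have h1 := relIndex_ker (K := T.comap (QuotientGroup.mk' X)) (QuotientGroup.mk' X)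
    rw [hker, map_comap_eq_self_of_surjective hs] at h1
    rwa [h1]
  · have h1 : T = ⊥ := by
      rw [← map_comap_eq_self_of_surjective hs T, hTX, hXbot]
    rw [← hcomap (hXA.trans hAC), h h1, hcomap hXA]

lemma relIndex_sup_sup_dvd {A B X : Subgroup G} (hX : X.Normal) :
    (A ⊔ X).relIndex (B ⊔ X) ∣ A.relIndex B := by
  have h1 := relIndex_map_map (QuotientGroup.mk' X) A B
  rw [QuotientGroup.ker_mk'] at h1
  rw [← h1, ← relIndex_comap]
  exact relIndex_dvd_of_le_left _ (le_comap_map _ A)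

lemma eq_of_sup_eq_of_le_frattini [Finite G] {P X Y : Subgroup G} (hΦ : ∀ M, M ⋖ P → X ≤ M)
    (h : Y ⊔ X = P) : Y = P := by
  by_contra hne
  obtain ⟨M, hYM, hM⟩ := exists_le_covBy_of_lt (lt_of_le_of_ne (h ▸ le_sup_left : Y ≤ P) hne)
  exact hM.lt.not_ge (h ▸ sup_le hYM (hΦ M hM))

lemma inf_eq_bot_of_ne {p q : ℕ} [hp : Fact p.Prime] [hq : Fact q.Prime] (hpq : q ≠ p)
    {X Q : Subgroup G} (hX : IsPGroup p X) (hQ : IsPGroup q Q) {x : G} (h1 : x ∈ X) (h2 : x ∈ Q) :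
    x = 1 := by
  have := (IsPGroup.disjoint_of_ne p q hpq.symm X Q hX hQ).le_bot ⟨h1, h2⟩
  simpa using this

section Frattini

variable [Finite G] {p : ℕ} [hp : Fact p.Prime] {P N X K : Subgroup G}

/-- By the Frattini argument `N = N_N(Q)K`. As `K/X` is a `p'`-group, a Sylow `p`-subgroup `P₁` of
`N_N(Q)` makes `P₁X` Sylow in `N`. After conjugation to `P`, the factor `X ≤ Φ(P)` is superfluous,
so `P₁` is already Sylow in `N` and contains `X`. -/
lemma le_normalizer_of_le_frattini (hP : SylowIn p P N) (hX : X.Normal)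
    (hXp : IsPGroup p X) (hXN : X ≤ N) (hΦ : ∀ M, M ⋖ P → X ≤ M) (hK : K.Normal) (hXK : X ≤ K)
    (hKN : K ≤ N) (hidx : ¬ p ∣ X.relIndex K) {q : ℕ} [hq : Fact q.Prime] (Q : Sylow q K) :
    X ≤ normalizer (((Q : Subgroup K).map K.subtype : Subgroup G) : Set G) := by
  set W : Subgroup G := normalizer (((Q : Subgroup K).map K.subtype : Subgroup G) : Set G) ⊓ N
    with hW
  have hWK : W ⊔ K = N := by
    rw [hW, ← sup_inf_of_le hK hKN, Sylow.normalizer_sup_eq_top Q, top_inf_eq]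
  obtain ⟨P₁, hP₁⟩ := SylowIn.exists_of p W
  have hS : SylowIn p (P₁ ⊔ X) N := by
    refine ⟨sup_le (hP₁.le.trans inf_le_right) hXN, hP₁.isPGroup.to_sup_of_normal_right hXp, ?_⟩
    rw [← relIndex_mul_relIndex (P₁ ⊔ X) (W ⊔ X) N (sup_le_sup_right hP₁.le X)
      (sup_le inf_le_right hXN), hp.out.dvd_mul]
    rintro (h | h)
    · exact hP₁.not_dvd (h.trans (relIndex_sup_sup_dvd hX))
    · have h1 : N = (W ⊔ X) ⊔ K := by rw [sup_assoc, sup_eq_right.2 hXK, hWK]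
      rw [h1] at h
      rw [relIndex_sup_self_of_normal hK] at h
      exact hidx (h.trans (relIndex_dvd_of_le_left K le_sup_right))
  obtain ⟨n, -, hn⟩ := hS.exists_conj hP
  rw [Subgroup.map_sup, map_conj_eq_of_normal hX] at hn
  have h1 := eq_of_sup_eq_of_le_frattini hΦ hn
  have hXP := hP.le_of_normal hX hXp hXN
  intro x hx
  have hx' : n * x * n⁻¹ ∈ P₁.map (MulAut.conj n).toMonoidHom := by
    rw [h1]; exact hXP (hX.conj_mem x hx n)
  obtain ⟨y, hy, hyx⟩ := hx'
  have h2 : y = x := (MulAut.conj n).injective hyx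
  exact (hP₁.le (h2 ▸ hy)).1

/-- No prime divides `|K : C_K(X)|`: for `p` because `X` is abelian, and for `q ≠ p` because a Sylow
`q`-subgroup `Q` of `K` and `X` normalize each other, so `[X, Q] ≤ X ∩ Q = 1`. -/
lemma le_centralizer_of_le_frattini (hP : SylowIn p P N) (hX : X.Normal)
    (hXp : IsPGroup p X) (hXc : X ≤ centralizer (X : Set G)) (hXN : X ≤ N)
    (hΦ : ∀ M, M ⋖ P → X ≤ M) (hK : K.Normal) (hXK : X ≤ K)
    (hKN : K ≤ N) (hidx : ¬ p ∣ X.relIndex K) : X ≤ centralizer (K : Set G) := by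
  rw [le_centralizer_iff, ← relIndex_eq_one, Nat.eq_one_iff_not_exists_prime_dvd]
  intro q hq hqd
  by_cases hqp : q = p
  · exact hidx (hqp ▸ hqd.trans (relIndex_dvd_of_le_left K hXc))
  · have := Fact.mk hq
    obtain ⟨Q⟩ := (inferInstance : Nonempty (Sylow q K))
    set Q' := (Q : Subgroup K).map K.subtype with hQ'
    have hnorm : X ≤ normalizer (Q' : Set G) :=
      le_normalizer_of_le_frattini hP hX hXp hXN hΦ hK hXK hKN hidx Q
    have hQp : IsPGroup q Q' := Q.2.map _
    have hQX : Q' ≤ centralizer (X : Set G) := by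
      intro y hy
      refine mem_centralizer_iff.2 fun x hx => ?_
      rw [← commutatorElement_eq_one_iff_mul_comm]
      refine inf_eq_bot_of_ne hqp hXp hQp ?_ ?_
      · rw [commutatorElement_def, mul_assoc, mul_assoc]
        refine mul_mem hx ?_
        rw [← mul_assoc]
        exact hX.conj_mem _ (inv_mem hx) y
      · rw [commutatorElement_def]
        exact mul_mem (le_normalizer_iff.1 hnorm x hx y hy) (inv_mem hy)
    refine Q.not_dvd_index ?_
    have h1 : Q'.relIndex K = (Q : Subgroup K).index := by
      rw [relIndex, subgroupOf, hQ', comap_map_eq_self_of_injective K.subtype_injective]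
    rw [← h1]
    exact hqd.trans (relIndex_dvd_of_le_left K hQX)

lemma eq_of_not_dvd_relIndex_of_le_frattini (hP : SylowIn p P N) (hX : X.Normal)
    (hXp : IsPGroup p X) (hXc : X ≤ centralizer (X : Set G)) (hXN : X ≤ N)
    (hΦ : ∀ M, M ⋖ P → X ≤ M)
    (hO : ∀ Y : Subgroup G, Y.Normal → Y ≤ N → ¬ p ∣ Nat.card Y → Y = ⊥) (hK : K.Normal)
    (hXK : X ≤ K) (hKN : K ≤ N) (hidx : ¬ p ∣ X.relIndex K) : K = X := by
  obtain ⟨T, hT, hTK, hTp, h⟩ := exists_normal_complement_of_central hX hK hXK hXp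
    (le_centralizer_of_le_frattini hP hX hXp hXc hXN hΦ hK hXK hKN hidx) hidx
  exact h (hO T hT (hTK.trans hKN) hTp)

end Frattini

/-! ### The common centralizer of the `p`-chief factors above `X`. -/

/-- The elements of `G` centralizing every chief factor of `G` between `X` and `N` of order
divisible by `p`. -/
def centralizerBetween (p : ℕ) (X N : Subgroup G) : Subgroup G where
  carrier := {g | ∀ K L : Subgroup G, IsChiefFactor K L → X ≤ K → L ≤ N → p ∣ K.relIndex L →
    ∀ l ∈ L, ⁅g, l⁆ ∈ K}
  one_mem' := fun K L _ _ _ _ l _ => by rw [commutatorElement_one_left]; exact one_mem K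
  mul_mem' := fun {a b} ha hb K L h hX hN hp l hl => by
    have h1 : ⁅a * b, l⁆ = a * ⁅b, l⁆ * a⁻¹ * ⁅a, l⁆ := by
      simp only [commutatorElement_def]; group
    rw [h1]
    exact mul_mem (h.normal_bot.conj_mem _ (hb K L h hX hN hp l hl) a) (ha K L h hX hN hp l hl)
  inv_mem' := fun {a} ha K L h hX hN hp l hl => by
    have h1 : ⁅a⁻¹, l⁆ = a⁻¹ * ⁅a, l⁆⁻¹ * a⁻¹⁻¹ := by
      simp only [commutatorElement_def]; group
    rw [h1]
    exact h.normal_bot.conj_mem _ (inv_mem (ha K L h hX hN hp l hl)) _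

lemma centralizerBetween_normal (p : ℕ) (X N : Subgroup G) : (centralizerBetween p X N).Normal := by
  refine ⟨fun n hn g K L h hX hN hp l hl => ?_⟩
  have h1 : ⁅g * n * g⁻¹, l⁆ = g * ⁅n, g⁻¹ * l * g⁻¹⁻¹⁆ * g⁻¹ := by
    simp only [commutatorElement_def]; group
  rw [h1]
  exact h.normal_bot.conj_mem _ (hn K L h hX hN hp _ (h.normal_top.conj_mem l hl g⁻¹)) g

lemma pow_mem_centralizer_of_card_eq_prime [Finite G] {p : ℕ} [hp : Fact p.Prime]
    {X : Subgroup G} (hX : X.Normal) (hcard : Nat.card X = p) (g : G) :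
    g ^ (p - 1) ∈ centralizer (X : Set G) := by
  have h1 : IsCyclic X := isCyclic_of_prime_card hcard
  have h2 : (MulAut.conjNormal (H := X) g) ^ (p - 1) = 1 := by
    have h3 := pow_card_eq_one' (x := MulAut.conjNormal (H := X) g)
    rwa [IsCyclic.card_mulAut, hcard, Nat.totient_prime hp.out] at h3
  rw [← map_pow] at h2
  refine mem_centralizer_iff.2 fun x hx => ?_
  have h4 := congrArg (fun f : MulAut X => ((f ⟨x, hx⟩ : X) : G)) h2
  simp only [MulAut.conjNormal_apply, MulAut.one_apply] at h4
  exact (mul_inv_eq_iff_eq_mul.1 h4).symm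

lemma commutatorElement_mem_of_map_mem {K L : Subgroup G} (hK : K.Normal) {g : G}
    (h : QuotientGroup.mk' K g ∈ centralizer (L.map (QuotientGroup.mk' K) : Set (G ⧸ K))) {l : G}
    (hl : l ∈ L) : ⁅g, l⁆ ∈ K := by
  have h1 := mem_centralizer_iff.1 h (QuotientGroup.mk' K l) ⟨l, hl, rfl⟩
  rw [← QuotientGroup.ker_mk' K, MonoidHom.mem_ker, map_commutatorElement,
    commutatorElement_eq_one_iff_mul_comm]
  exact h1.symm

lemma card_map_mk' {p : ℕ} {K L : Subgroup G} [K.Normal] (h : K.relIndex L = p) :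
    Nat.card (L.map (QuotientGroup.mk' K)) = p := by
  rw [← relIndex_ker, QuotientGroup.ker_mk', h]

lemma pow_conj_of_commute {g x c : G} (h : g * x * g⁻¹ = c * x) (hc : Commute g c) (n : ℕ) :
    g ^ n * x * (g ^ n)⁻¹ = c ^ n * x := by
  induction n with
  | zero => simp
  | succ n ih =>
    have h1 : g ^ (n + 1) * x * (g ^ (n + 1))⁻¹ = g ^ n * (g * x * g⁻¹) * (g ^ n)⁻¹ := by
      rw [pow_succ]; group
    have h2 : g ^ n * (c * x) * (g ^ n)⁻¹ = c * (g ^ n * x * (g ^ n)⁻¹) := by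
      rw [← mul_assoc, (hc.pow_left n).eq, mul_assoc, mul_assoc, mul_assoc]
    rw [h1, h, h2, ih, pow_succ', mul_assoc]

section CentralizerBetween

variable [Finite G] {p : ℕ} [hp : Fact p.Prime] {X N : Subgroup G}

lemma CyclicBetween.commutator_le (h : CyclicBetween p X N) :
    ⁅(⊤ : Subgroup G), (⊤ : Subgroup G)⁆ ≤ centralizerBetween p X N := by
  intro g hg K L hKL hX hN hpL l hl
  have := hKL.normal_bot
  have hs := QuotientGroup.mk'_surjective K
  refine commutatorElement_mem_of_map_mem hKL.normal_bot ?_ hl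
  refine commutator_le_centralizer_of_card_eq_prime (hKL.normal_top.map _ hs)
    (card_map_mk' (h K L hKL hX hN hpL)) ((⊤ : Subgroup G).map (QuotientGroup.mk' K)) ?_
  rw [← map_commutator]
  exact ⟨g, hg, rfl⟩

lemma CyclicBetween.pow_mem (h : CyclicBetween p X N) (g : G) :
    g ^ (p - 1) ∈ centralizerBetween p X N := by
  intro K L hKL hX hN hpL l hl
  have := hKL.normal_bot
  have hs := QuotientGroup.mk'_surjective K
  refine commutatorElement_mem_of_map_mem hKL.normal_bot ?_ hl
  rw [map_pow]
  exact pow_mem_centralizer_of_card_eq_prime (hKL.normal_top.map _ hs)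
    (card_map_mk' (h K L hKL hX hN hpL)) _

/-- Modulo this centralizer every element has order dividing `p - 1`, which is prime to `p`. -/
lemma CyclicBetween.mem_of_isPGroup (h : CyclicBetween p X N) {P : Subgroup G}
    (hP : IsPGroup p P) : P ≤ centralizerBetween p X N := by
  intro g hg
  have := centralizerBetween_normal p X N
  rw [← QuotientGroup.eq_one_iff, ← orderOf_eq_one_iff]
  obtain ⟨k, hk⟩ := hP ⟨g, hg⟩
  have hk' : g ^ p ^ k = 1 := congrArg Subtype.val hk
  refine Nat.eq_one_of_dvd_coprimes (a := p ^ k) (b := p - 1) ?_ ?_ ?_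
  · refine Nat.Coprime.pow_left _ ((Nat.Prime.coprime_iff_not_dvd hp.out).2 fun hd => ?_)
    have := Nat.le_of_dvd (Nat.sub_pos_of_lt hp.out.one_lt) hd
    have := hp.out.pos
    omega
  · rw [orderOf_dvd_iff_pow_eq_one, ← QuotientGroup.mk_pow, hk', QuotientGroup.mk_one]
  · rw [orderOf_dvd_iff_pow_eq_one, ← QuotientGroup.mk_pow, QuotientGroup.eq_one_iff]
    exact h.pow_mem g

/-- Coprime action: a `p'`-element centralizing all `p`-chief factors above `X` centralizes `O / X`
for every normal `p`-subgroup `O`. -/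
lemma commutatorElement_mem_of_mem_centralizerBetween (hX : X.Normal) {O : Subgroup G}
    (hO : O.Normal) (hOp : IsPGroup p O) (hXO : X ≤ O) (hON : O ≤ N) {g : G}
    (hg : g ∈ centralizerBetween p X N) (hgp : ¬ p ∣ orderOf g) : ∀ x ∈ O, ⁅g, x⁆ ∈ X := by
  induction O using WellFoundedLT.induction with
  | ind O ih =>
    intro x hx
    rcases hXO.eq_or_lt with h | h
    · rw [commutatorElement_def]
      rw [← h] at hx
      exact mul_mem (hX.conj_mem x hx g) (inv_mem hx)
    · obtain ⟨U, hU, hXU⟩ := exists_isChiefFactor_below hX hO h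
      have hpU : p ∣ U.relIndex O := by
        obtain ⟨m, hm⟩ := exists_relIndex_eq_pow hOp U
        rw [hm]
        refine dvd_pow_self p fun h0 => ?_
        rw [h0, pow_zero] at hm
        exact hU.lt.not_ge (relIndex_eq_one.1 hm)
      have hc := hg U O hU hXU hON hpU x hx
      have hgc := ih U hU.lt hU.normal_bot (hOp.to_le hU.lt.le) hXU (hU.lt.le.trans hON) _ hc
      -- Modulo `X`, `g` commutes with `c`, so `gⁿxg⁻ⁿ = cⁿx`. Taking `n` to be the order of `g`
      -- gives `cⁿ = 1` modulo `X`, while `c` is a `p`-element.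
      set c := ⁅g, x⁆ with hcdef
      have hcX : ((c : G) : G ⧸ X) ^ orderOf g = 1 := by
        have h1 : (g : G ⧸ X) * x * (g : G ⧸ X)⁻¹ = c * x := by
          rw [hcdef, ← QuotientGroup.mk_inv, ← QuotientGroup.mk_mul, ← QuotientGroup.mk_mul,
            ← QuotientGroup.mk_mul, commutatorElement_def, inv_mul_cancel_right]
        have h2 : Commute (g : G ⧸ X) (c : G ⧸ X) := by
          have h3 := (QuotientGroup.eq_one_iff _).2 hgc
          rw [← QuotientGroup.mk'_apply, map_commutatorElement,
            commutatorElement_eq_one_iff_mul_comm] at h3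
          exact h3
        have h3 := pow_conj_of_commute h1 h2 (orderOf g)
        rw [← QuotientGroup.mk_pow, pow_orderOf_eq_one, QuotientGroup.mk_one, one_mul, inv_one,
          mul_one] at h3
        exact right_eq_mul.1 h3
      obtain ⟨k, hk⟩ := hOp ⟨c, hU.lt.le hc⟩
      have hk' : c ^ p ^ k = 1 := congrArg Subtype.val hk
      rw [← QuotientGroup.eq_one_iff, ← orderOf_eq_one_iff]
      refine Nat.eq_one_of_dvd_coprimes (a := p ^ k) (b := orderOf g) ?_ ?_
        (orderOf_dvd_of_pow_eq_one hcX)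
      · exact Nat.Coprime.pow_left _ ((Nat.Prime.coprime_iff_not_dvd hp.out).2 hgp)
      · rw [orderOf_dvd_iff_pow_eq_one, ← QuotientGroup.mk_pow, hk', QuotientGroup.mk_one]

end CentralizerBetween

/-! ### Irreducible abelian actions of exponent dividing `p - 1`. -/

/-- The minimal polynomial of `f` divides `X ^ p - X`, which splits over `ZMod p`. -/
lemma exists_eigenvector_of_pow_eq {V : Type*} [AddCommGroup V] [Finite V] [Nontrivial V] {p : ℕ}
    [hp : Fact p.Prime] [Module (ZMod p) V] (f : Module.End (ZMod p) V) (hpow : f ^ p = f) :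
    ∃ v, v ≠ 0 ∧ ∃ a : ZMod p, f v = a • v := by
  have hdvd : minpoly (ZMod p) f ∣ (Polynomial.X ^ p - Polynomial.X : Polynomial (ZMod p)) := by
    apply minpoly.dvd
    rw [map_sub, map_pow, Polynomial.aeval_X, hpow, sub_self]
  have hsplit : (minpoly (ZMod p) f).Splits := by
    have h1 := FiniteField.splits_X_pow_card_sub_X (K := ZMod p) p
    rw [ZMod.card, Algebra.algebraMap_self, Polynomial.map_id] at h1
    exact h1.of_dvd (FiniteField.X_pow_card_sub_X_ne_zero _ hp.out.one_lt) hdvd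
  obtain ⟨a, ha⟩ := hsplit.exists_eval_eq_zero
    (minpoly.degree_pos (Algebra.IsIntegral.isIntegral f)).ne'
  obtain ⟨v, hv⟩ := (Module.End.hasEigenvalue_of_isRoot ha).exists_hasEigenvector
  exact ⟨v, hv.2, a, hv.apply_eq_smul⟩

lemma exists_nsmul_of_iterate_eq {V : Type*} [AddCommGroup V] [Finite V] [Nontrivial V] {p : ℕ}
    [hp : Fact p.Prime] [Module (ZMod p) V] (σ : V →+ V)
    (hσ : ∀ x, σ^[p - 1] x = x) : ∃ x, x ≠ 0 ∧ ∃ k : ℕ, σ x = k • x := by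
  let f : Module.End (ZMod p) V := σ.toZModLinearMap p
  have hpow : f ^ p = f := by
    have h1 : f ^ (p - 1) = 1 := by
      ext x
      rw [Module.End.pow_apply]
      exact hσ x
    calc f ^ p = f ^ (p - 1 + 1) := by rw [Nat.sub_add_cancel hp.out.one_le]
      _ = f := by rw [pow_succ, h1, one_mul]
  obtain ⟨v, hv, a, ha⟩ := exists_eigenvector_of_pow_eq f hpow
  refine ⟨v, hv, a.val, ?_⟩
  have h2 : a • v = a.val • v := by
    conv_lhs => rw [← ZMod.natCast_zmod_val a]
    rw [Nat.cast_smul_eq_nsmul]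
  rw [← h2]
  exact ha

lemma exists_eq_pow_of_iterate_eq {X : Type*} [CommGroup X] [Finite X] [Nontrivial X] {p : ℕ}
    [hp : Fact p.Prime] (hexp : ∀ x : X, x ^ p = 1) (σ : X →* X)
    (hσ : ∀ x, σ^[p - 1] x = x) : ∃ x, x ≠ 1 ∧ ∃ k : ℕ, σ x = x ^ k :=
  @exists_nsmul_of_iterate_eq (Additive X) _ _ _ p _ (AddCommGroup.zmodModule hexp)
    (MonoidHom.toAdditive σ) hσ

section

variable [Finite G] {p : ℕ} [hp : Fact p.Prime] {X : Subgroup G}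

/-- A minimal normal `p`-subgroup on which `G` acts as an abelian group of exponent dividing
`p - 1` has order `p`. -/
lemma card_eq_of_abelian_action (hX : IsChiefFactor ⊥ X) (hXp : IsPGroup p X)
    (hab : ⁅(⊤ : Subgroup G), (⊤ : Subgroup G)⁆ ≤ centralizer (X : Set G))
    (hpow : ∀ g : G, g ^ (p - 1) ∈ centralizer (X : Set G)) : Nat.card X = p := by
  have hXn := hX.normal_top
  have hXc := commute_of_isChiefFactor_bot hX hXp
  have hexp : ∀ x ∈ X, x ^ p = 1 := fun x hx =>
    pow_eq_one_of_isChiefFactor_bot hX hXc (dvd_card_of_isPGroup hXp hX.lt.ne') hx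
  have hnt : Nontrivial X := (nontrivial_iff_ne_bot X).2 hX.lt.ne'
  let _ : CommGroup X :=
    { (inferInstance : Group X) with
      mul_comm := fun a b => Subtype.ext (mem_centralizer_iff.1 (hXc b.2) a a.2) }
  have key : ∀ g : G, ∃ k : ℕ, ∀ x ∈ X, g * x * g⁻¹ = x ^ k := by
    intro g
    obtain ⟨y, hy, k, hk⟩ := exists_eq_pow_of_iterate_eq (X := X) (p := p)
      (fun x => Subtype.ext (hexp x x.2)) (MulAut.conjNormal g).toMonoidHom (fun x => by
        have h1 : ∀ n, (((MulAut.conjNormal g).toMonoidHom : X →* X)^[n] x : G)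
            = g ^ n * x * (g ^ n)⁻¹ := fun n => by
          induction n with
          | zero => simp
          | succ n ih =>
            rw [Function.iterate_succ_apply']
            change g * _ * g⁻¹ = _
            rw [ih, pow_succ']; group
        refine Subtype.ext ?_
        rw [h1, mul_inv_eq_iff_eq_mul]
        exact (mem_centralizer_iff.1 (hpow g) x x.2).symm)
    refine ⟨k, ?_⟩
    have hk' : g * (y : G) * g⁻¹ = (y : G) ^ k := congrArg Subtype.val hk
    -- The eigenspace of `g` for the eigenvalue `k`. It is normal because `G` acts on `X` as an
    -- abelian group, so it is all of `X` and `g` acts as a scalar. Consequently every cyclic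
    -- subgroup of `X` is normal in `G`.
    let A : Subgroup G :=
      { carrier := {x | x ∈ X ∧ g * x * g⁻¹ = x ^ k}
        one_mem' := ⟨one_mem X, by simp⟩
        mul_mem' := fun {a b} ha hb => ⟨mul_mem ha.1 hb.1, by
          have : Commute a b := mem_centralizer_iff.1 (hXc hb.1) a ha.1
          rw [this.mul_pow, ← ha.2, ← hb.2]; group⟩
        inv_mem' := fun {a} ha => ⟨inv_mem ha.1, by rw [inv_pow, ← ha.2]; group⟩ }
    have hA : A.Normal := ⟨fun n hn h => ⟨hXn.conj_mem n hn.1 h, by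
      have h1 := mem_centralizer_iff.1 (hab (commutator_mem_commutator (mem_top g⁻¹) (mem_top h⁻¹)))
        n hn.1
      have h2 : g * (h * n * h⁻¹) * g⁻¹ = h * g * (⁅g⁻¹, h⁻¹⁆ * n) * g⁻¹ * h⁻¹ * ⁅h, g⁆ := by
        simp only [commutatorElement_def]; group
      have h3 : h * g * (n * ⁅g⁻¹, h⁻¹⁆) * g⁻¹ * h⁻¹ * ⁅h, g⁆ = h * (g * n * g⁻¹) * h⁻¹ := by
        simp only [commutatorElement_def]; group
      rw [h2, ← h1, h3, hn.2, conj_pow]⟩⟩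
    have hne : A ≠ ⊥ := fun h => by
      have h1 : (y : G) ∈ A := ⟨y.2, hk'⟩
      rw [h, mem_bot] at h1
      exact hy (Subtype.ext h1)
    have hAX := hX.eq_of_ne_bot hA (fun x hx => hx.1) hne
    intro x hx
    rw [← hAX] at hx
    exact hx.2
  obtain ⟨x, hx⟩ := exists_ne (1 : X)
  have hzn : (zpowers (x : G)).Normal := by
    refine ⟨fun n hn g => ?_⟩
    obtain ⟨i, rfl⟩ := mem_zpowers_iff.1 hn
    obtain ⟨k, hk⟩ := key g
    rw [hk _ (zpow_mem x.2 i)]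
    exact pow_mem (zpow_mem (mem_zpowers _) i) k
  have hz := hX.eq_of_ne_bot hzn (zpowers_le.2 x.2)
    (fun h => hx (Subtype.ext (zpowers_eq_bot.1 h)))
  rw [← hz, Nat.card_zpowers]
  exact orderOf_eq_prime (hexp x x.2) fun h => hx (Subtype.ext h)

end

lemma conj_commutator_mem_of_normal {X : Subgroup G} (hX : X.Normal) {x g : G} (hx : x ∈ X) :
    ⁅x, g⁆ ∈ X := by
  rw [commutatorElement_def, mul_assoc, mul_assoc]
  refine mul_mem hx ?_
  rw [← mul_assoc]
  exact hX.conj_mem _ (inv_mem hx) g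

lemma not_dvd_orderOf_of_mem_isPGroup {p q : ℕ} [hp : Fact p.Prime] [hq : Fact q.Prime]
    (hqp : q ≠ p) {Q : Subgroup G} (hQ : IsPGroup q Q) {g : G} (hg : g ∈ Q) :
    ¬ p ∣ orderOf g := by
  obtain ⟨k, hk⟩ := hQ ⟨g, hg⟩
  have h1 : orderOf g ∣ q ^ k := orderOf_dvd_of_pow_eq_one (congrArg Subtype.val hk)
  exact fun h => hqp ((Nat.prime_dvd_prime_iff_eq hp.out hq.out).1
    (hp.out.dvd_of_dvd_pow (h.trans h1))).symm

/-! ### The case `X ≤ Φ(P)`. -/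

section Frattini

variable [Finite G] {p : ℕ} [hp : Fact p.Prime] {P N X : Subgroup G}

/-- `Q` acts by conjugation on each coset `xX` with `x ∈ P`. Its size is a power of `p`, so the
`q`-group `Q` fixes a point. Thus `P = C_P(Q)X`, and `X ≤ Φ(P)` can be dropped. -/
lemma le_centralizer_of_commutatorElement_mem (hX : X.Normal) (hXp : IsPGroup p X) (hXP : X ≤ P)
    (hΦ : ∀ M, M ⋖ P → X ≤ M) {q : ℕ} [hq : Fact q.Prime] (hqp : q ≠ p) {Q : Subgroup G}
    (hQ : IsPGroup q Q) (h : ∀ g ∈ Q, ∀ x ∈ P, ⁅g, x⁆ ∈ X) : P ≤ centralizer (Q : Set G) := by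
  have hfix : P ≤ (P ⊓ centralizer (Q : Set G)) ⊔ X := by
    intro x hx
    let α := {y : G // x⁻¹ * y ∈ X}
    let _ : MulAction Q α :=
      { smul := fun g y => ⟨g * y * (g : G)⁻¹, by
          have h1 : x⁻¹ * (g * y * (g : G)⁻¹) =
              x⁻¹ * ⁅(g : G), x⁆ * x⁻¹⁻¹ * (g * (x⁻¹ * y) * (g : G)⁻¹) := by
            simp only [commutatorElement_def]; group
          rw [h1]
          exact mul_mem (hX.conj_mem _ (h g g.2 x hx) _) (hX.conj_mem _ y.2 _)⟩
        one_smul := fun y => Subtype.ext (by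
          change ((1 : Q) : G) * y * ((1 : Q) : G)⁻¹ = y
          simp)
        mul_smul := fun a b y => Subtype.ext (by
          change ((a * b : Q) : G) * y * ((a * b : Q) : G)⁻¹ = a * (b * y * (b : G)⁻¹) * (a : G)⁻¹
          simp [mul_assoc]) }
    have hcard : Nat.card α = Nat.card X :=
      Nat.card_congr ((Equiv.mulLeft x⁻¹).subtypeEquiv fun y => Iff.rfl)
    have hq' : ¬ q ∣ Nat.card α := by
      obtain ⟨k, hk⟩ := IsPGroup.iff_card.1 hXp
      rw [hcard, hk]
      exact fun hd => hqp ((Nat.prime_dvd_prime_iff_eq hq.out hp.out).1 (hq.out.dvd_of_dvd_pow hd))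
    obtain ⟨y, hy⟩ := hQ.nonempty_fixed_point_of_prime_not_dvd_card α hq'
    have hyc : (y : G) ∈ P ⊓ centralizer (Q : Set G) := by
      refine mem_inf.2 ⟨?_, mem_centralizer_iff.2 fun g hg => ?_⟩
      · have := mul_mem hx (hXP y.2)
        rwa [mul_inv_cancel_left] at this
      · exact mul_inv_eq_iff_eq_mul.1 (congrArg Subtype.val (hy ⟨g, hg⟩))
    have h2 : x = y * (x⁻¹ * y)⁻¹ := by group
    rw [h2]
    exact mul_mem (le_sup_left (a := P ⊓ centralizer (Q : Set G)) hyc)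
      (le_sup_right (a := P ⊓ centralizer (Q : Set G)) (inv_mem y.2))
  have h1 := eq_of_sup_eq_of_le_frattini hΦ (le_antisymm (sup_le inf_le_left hXP) hfix)
  exact inf_eq_left.1 h1

/-- With trivial `p'`-part, the common centralizer of the `p`-chief factors above `X` is a `p`-group
inside `N`. -/
lemma isPGroup_centralizerBetween_inf (hN : N.Normal) (hP : SylowIn p P N) (hX : X.Normal)
    (hXp : IsPGroup p X) (hXc : X ≤ centralizer (X : Set G)) (hXN : X ≤ N)
    (hΦ : ∀ M, M ⋖ P → X ≤ M)
    (hO : ∀ Y : Subgroup G, Y.Normal → Y ≤ N → ¬ p ∣ Nat.card Y → Y = ⊥)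
    (h : CyclicBetween p X N) : IsPGroup p (centralizerBetween p X N ⊓ N : Subgroup G) := by
  have hBn := centralizerBetween_normal p X N
  set R := centralizerBetween p X N ⊓ N with hR
  have hRn : R.Normal := inferInstance
  have hXR : X ≤ R := le_inf (fun x hx K L hKL hXK _ _ l _ =>
    hXK (conj_commutator_mem_of_normal hX hx)) hXN
  obtain ⟨O, hOmax⟩ := (Set.toFinite {O : Subgroup G | O.Normal ∧ IsPGroup p O ∧ X ≤ O ∧ O ≤ R}).exists_maximal
    ⟨X, hX, hXp, le_rfl, hXR⟩
  obtain ⟨⟨hOn, hOp, hXO, hOR⟩, hmax⟩ := hOmax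
  rcases hOR.eq_or_lt with hOR' | hOR'
  · exact hOR' ▸ hOp
  · exfalso
    obtain ⟨Y, hY, hYR⟩ := exists_isChiefFactor_above hOn hRn hOR'
    have hYn := hY.normal_top
    have hYN : Y ≤ N := hYR.trans inf_le_right
    have hYp : ¬ IsPGroup p Y := fun hYp =>
      hY.lt.not_ge (hmax ⟨hYn, hYp, hXO.trans hY.lt.le, hYR⟩ hY.lt.le)
    have hpY : ¬ p ∣ O.relIndex Y := fun hd =>
      hYp (isPGroup_of_relIndex hY.lt.le hOp (m := 1) (by
        rw [h O Y hY hXO hYN hd, pow_one]))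
    -- `Z` is the centralizer of `O/X`, and the aim is `Y ∩ Z ≤ O`: the part of `O` in `C = Y ∩ Z`
    -- is central modulo `X` and of `p'`-index in `C`, so it has a normal `p'`-complement modulo
    -- `X`, which must be trivial.
    let Z : Subgroup G := (centralizer (O.map (QuotientGroup.mk' X) : Set (G ⧸ X))).comap (QuotientGroup.mk' X)
    have hZn : Z.Normal := by
      have := hOn.map (QuotientGroup.mk' X) (QuotientGroup.mk'_surjective X)
      exact inferInstance
    have hZ : ∀ z, z ∈ Z ↔ ∀ o ∈ O, ⁅z, o⁆ ∈ X := fun z => by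
      constructor
      · exact fun hz o ho => commutatorElement_mem_of_map_mem hX hz ho
      · rintro hz
        refine mem_centralizer_iff.2 ?_
        rintro _ ⟨o, ho, rfl⟩
        have h1 := hz o ho
        rw [← QuotientGroup.ker_mk' X, MonoidHom.mem_ker, map_commutatorElement,
          commutatorElement_eq_one_iff_mul_comm] at h1
        exact h1.symm
    set C := Y ⊓ Z with hC
    have hCn : C.Normal := inferInstance
    have hXC : X ≤ C := le_inf (hXO.trans hY.lt.le) fun x hx =>
      (hZ x).2 fun o _ => conj_commutator_mem_of_normal hX hx
    obtain ⟨T, hT, hXT, hTC, hTp, hTX⟩ := exists_normal_complement_mod (p := p) (A := C ⊓ O) hX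
      inferInstance hCn (le_inf hXC hXO) inf_le_left (hOp.to_le inf_le_right)
      (commutator_le.2 fun a ha c hc => by
        have h1 := (hZ c).1 (mem_inf.1 hc).2 a (mem_inf.1 ha).2
        rw [← commutatorElement_inv]
        exact inv_mem h1)
      (by
        rw [inf_relIndex_left, ← relIndex_sup_right]
        intro hd
        refine hpY (hd.trans ?_)
        exact Dvd.intro _ (relIndex_mul_relIndex O (C ⊔ O) Y le_sup_right
          (sup_le inf_le_left hY.lt.le)))
    have hCO : C ≤ O := by
      rw [hTX (eq_of_not_dvd_relIndex_of_le_frattini hP hX hXp hXc hXN hΦ hO hT hXT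
        (hTC.trans (inf_le_left.trans hYN)) hTp)]
      exact inf_le_right
    -- `Y/O` is a nontrivial `p'`-group. An element of prime order `q ≠ p` in `Y` centralizes `O/X`
    -- by coprime action, so it lies in `C ≤ O`, which is a `p`-group.
    have hne : O.relIndex Y ≠ 1 := fun h1 => hY.lt.not_ge (relIndex_eq_one.1 h1)
    obtain ⟨q, hq, hqd⟩ := Nat.exists_prime_and_dvd hne
    have := Fact.mk hq
    have hqp : q ≠ p := fun h1 => hpY (h1 ▸ hqd)
    obtain ⟨y, hy⟩ := exists_prime_orderOf_dvd_card' q (hqd.trans (relIndex_dvd_card O Y))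
    have hyo : orderOf (y : G) = q := by rw [orderOf_coe, hy]
    have hyp : ¬ p ∣ orderOf (y : G) := fun hd => hqp
      ((Nat.prime_dvd_prime_iff_eq hp.out hq).1 (hyo ▸ hd)).symm
    have hyC : (y : G) ∈ C := mem_inf.2 ⟨y.2, (hZ _).2
      (commutatorElement_mem_of_mem_centralizerBetween hX hOn hOp hXO (hY.lt.le.trans hYN)
        (mem_inf.1 (hYR y.2)).1 hyp)⟩
    obtain ⟨k, hk⟩ := hOp ⟨y, hCO hyC⟩
    have h2 : orderOf (y : G) ∣ p ^ k := orderOf_dvd_of_pow_eq_one (congrArg Subtype.val hk)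
    rw [hyo] at h2
    exact hqp ((Nat.prime_dvd_prime_iff_eq hq hp.out).1 (hq.dvd_of_dvd_pow h2))

/-- For `q ≠ p`, a Sylow `q`-subgroup of `B = centralizerBetween p X N` centralizes `P/X`, hence
`P`, hence `X`. So `B` acts on `X` as a `p`-group and has nontrivial fixed points; these form a
normal subgroup, so `B` centralizes `X`. Since `B` contains `[G, G]` and all `(p - 1)`-th powers,
the result on abelian actions applies. -/
lemma card_eq_of_le_frattini (hN : N.Normal) (hP : SylowIn p P N) (hX : IsChiefFactor ⊥ X)
    (hXp : IsPGroup p X) (hXN : X ≤ N) (hΦ : ∀ M, M ⋖ P → X ≤ M)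
    (hO : ∀ Y : Subgroup G, Y.Normal → Y ≤ N → ¬ p ∣ Nat.card Y → Y = ⊥)
    (h : CyclicBetween p X N) : Nat.card X = p := by
  have hXn := hX.normal_top
  have hXc := commute_of_isChiefFactor_bot hX hXp
  have hXP := hP.le_of_normal hXn hXp hXN
  set B := centralizerBetween p X N with hB
  have hBn : B.Normal := centralizerBetween_normal p X N
  have hBP : B ⊓ N = P := hP.eq_of_le
    (isPGroup_centralizerBetween_inf hN hP hXn hXp hXc hXN hΦ hO h) inf_le_right
    (le_inf (h.mem_of_isPGroup hP.isPGroup) hP.le)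
  have hPn : P.Normal := hBP ▸ inferInstance
  let φ := MulAut.conjNormal (H := X)
  have hker : ∀ g, g ∈ φ.ker ↔ g ∈ centralizer (X : Set G) := fun g => by
    rw [MonoidHom.mem_ker, mem_centralizer_iff]
    constructor
    · intro hg x hx
      have h1 := congrArg (fun f : MulAut X => ((f ⟨x, hx⟩ : X) : G)) hg
      exact (mul_inv_eq_iff_eq_mul.1 h1).symm
    · intro hg
      ext x
      exact mul_inv_eq_iff_eq_mul.2 (hg x x.2).symm
  have hBφ : IsPGroup p (B.map φ) := by
    refine IsPGroup.iff_card.2 ⟨_, Nat.eq_prime_pow_of_unique_prime_dvd Nat.card_pos.ne'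
      fun {q} hq hqd => ?_⟩
    by_contra hqp
    have := Fact.mk hq
    obtain ⟨Q, hQ⟩ := SylowIn.exists_of q B
    rw [← relIndex_ker] at hqd
    refine hQ.not_dvd (hqd.trans (relIndex_dvd_of_le_left B fun g hg => (hker g).2 ?_))
    have h1 : P ≤ centralizer (Q : Set G) :=
      le_centralizer_of_commutatorElement_mem hXn hXp hXP hΦ hqp hQ.isPGroup fun g hg x hx =>
        commutatorElement_mem_of_mem_centralizerBetween hXn hPn hP.isPGroup hXP hP.le (hQ.le hg)
          (not_dvd_orderOf_of_mem_isPGroup hqp hQ.isPGroup hg) x hx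
    exact le_centralizer_iff.1 (hXP.trans h1) hg
  obtain ⟨x, hx, hx1⟩ := hBφ.exists_fixed_point_of_prime_dvd_card_of_fixed_point X
    (dvd_card_of_isPGroup hXp hX.lt.ne') (a := 1) (fun g => map_one (g : MulAut X))
  have hxB : (x : G) ∈ X ⊓ centralizer (B : Set G) := by
    refine mem_inf.2 ⟨x.2, mem_centralizer_iff.2 fun g hg => ?_⟩
    have h1 := hx ⟨φ g, ⟨g, hg, rfl⟩⟩
    exact mul_inv_eq_iff_eq_mul.1 (congrArg Subtype.val h1)
  have hne : X ⊓ centralizer (B : Set G) ≠ ⊥ := fun h0 => by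
    rw [h0, mem_bot] at hxB
    exact hx1 (Subtype.ext hxB).symm
  have hXB : B ≤ centralizer (X : Set G) := by
    rw [← le_centralizer_iff, ← hX.eq_of_ne_bot inferInstance inf_le_left hne]
    exact inf_le_right
  exact card_eq_of_abelian_action hX hXp (h.commutator_le.trans hXB) fun g => hXB (h.pow_mem g)

end Frattini

end

/-! ### The induction on the order of `G`. -/

lemma CyclicBetween.of_quotient {G : Type*} [Group G] {p : ℕ} {Y N : Subgroup G} [hYn : Y.Normal]
    (hYN : Y ≤ N) (hY : CyclicBetween p ⊥ Y)
    (h : CyclicBetween p ⊥ (N.map (QuotientGroup.mk' Y))) : CyclicBetween p ⊥ N := by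
  have h1 := h.of_map (QuotientGroup.mk'_surjective Y)
  rw [QuotientGroup.ker_mk'] at h1
  exact hY.trans hYn h1 hYN

lemma card_quotient_lt {G : Type*} [Group G] [Finite G] {Y : Subgroup G} (hY : Y ≠ ⊥) :
    Nat.card (G ⧸ Y) < Nat.card G := by
  rw [card_eq_card_quotient_mul_card_subgroup Y]
  exact lt_mul_of_one_lt_right Nat.card_pos (one_lt_card_iff_ne_bot Y |>.2 hY)

theorem cyclicBetween_of_maximalICPi {G : Type*} [Group G] [Finite G] {p : ℕ} [hp : Fact p.Prime]
    {P N : Subgroup G} (hN : N.Normal) (hP : SylowIn p P N) (h : MaximalICPi p P)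
    (hcard : Nat.card P ≠ p) : CyclicBetween p ⊥ N := by
  induction hn : Nat.card G using Nat.strong_induction_on generalizing G with
  | _ n ih =>
    subst hn
    by_cases hO : ∃ Y : Subgroup G, Y.Normal ∧ Y ≤ N ∧ ¬ p ∣ Nat.card Y ∧ Y ≠ ⊥
    · obtain ⟨Y, hYn, hYN, hYp, hY⟩ := hO
      have hs := QuotientGroup.mk'_surjective Y
      have hker : ¬ p ∣ Nat.card (QuotientGroup.mk' Y).ker := by rwa [QuotientGroup.ker_mk']
      refine CyclicBetween.of_quotient hYN (CyclicBetween.of_not_dvd hYp) ?_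
      refine ih _ (card_quotient_lt hY) (hN.map _ hs) (hP.map (by rwa [QuotientGroup.ker_mk']))
        (h.map hs hP.isPGroup (Or.inr hker)) ?_ rfl
      rwa [card_map_of_not_dvd hP.isPGroup hker]
    · have hO' : ∀ Y : Subgroup G, Y.Normal → Y ≤ N → ¬ p ∣ Nat.card Y → Y = ⊥ :=
        fun Y h1 h2 h3 => by
          by_contra h4
          exact hO ⟨Y, h1, h2, h3, h4⟩
      by_cases hNbot : N = ⊥
      · rw [hNbot]
        exact CyclicBetween.of_not_dvd (by rw [card_bot]; exact hp.out.not_dvd_one)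
      · obtain ⟨X, hX, hXN⟩ := exists_isChiefFactor_above normal_bot hN (bot_lt_iff_ne_bot.2 hNbot)
        have hXn := hX.normal_top
        have hXne : X ≠ ⊥ := hX.lt.ne'
        have hpX : p ∣ Nat.card X := by
          by_contra hc
          exact hXne (hO' X hXn hXN hc)
        have hXp := h.isPGroup_of_isChiefFactor hP hX hXN hpX hcard
        have hXP := hP.le_of_normal hXn hXp hXN
        have hs := QuotientGroup.mk'_surjective X
        have hker := QuotientGroup.ker_mk' X
        have hXNc : CyclicBetween p X N := by
          -- When `|P/X| = p`, the quotient `G/X` violates the condition `|P| ≠ p` of the induction.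
          by_cases hidx : X.relIndex P = p
          · exact h.cyclicBetween_of_relIndex_eq hN hP hX hXp hXN
              (covBy_of_relIndex_eq_prime hXP hidx) hO'
          · have h1 := ih _ (card_quotient_lt hXne) (hN.map _ hs) (hP.map (by rwa [hker]))
              (h.map hs hP.isPGroup (Or.inl (by rwa [hker])))
              (by rwa [← relIndex_ker, hker]) rfl
            have h2 := h1.of_map hs
            rwa [hker] at h2
        have hXcard : Nat.card X = p := by
          by_cases hM : ∃ M, M ⋖ P ∧ ¬ X ≤ M
          · obtain ⟨M, hM, hXM⟩ := hM
            exact h.card_eq_of_not_le hN hP hX hXp hXN hM hXM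
          · push Not at hM
            exact card_eq_of_le_frattini hN hP hX hXp hXN hM hO' hXNc
        exact (CyclicBetween.of_card_eq hXcard hX).trans hXn hXNc hXN

lemma CyclicBetween.cyclicChiefFactorsBelow {G : Type*} [Group G] {p : ℕ} [Fact p.Prime]
    {N : Subgroup G} (h : CyclicBetween p ⊥ N) : CyclicChiefFactorsBelow p N := by
  intro K L _ hKL hLN hpL
  have h1 : Nat.card (imageMod K L) = K.relIndex L := by
    rw [imageMod, ← relIndex_ker, QuotientGroup.ker_mk']
  rw [h1] at hpL
  exact isCyclic_of_prime_card (p := p) (h1.trans (h K L hKL bot_le hLN hpL))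

end ICPi

theorem theoremD {G : Type*} [Group G] [Finite G] (p : ℕ) [Fact p.Prime]
    (N : Subgroup G) (hN : N.Normal) (P : Sylow p N)
    (hP : ∀ M : Subgroup G, M ⋖ (P : Subgroup N).map N.subtype → SatisfiesICPi M) :
    Nat.card P = p ∨ N ≤ pSupersolubleHypercenter p G := by
  have hcard : Nat.card ((P : Subgroup N).map N.subtype) = Nat.card P :=
    Subgroup.card_map_of_injective N.subtype_injective
  have hS : ICPi.SylowIn p ((P : Subgroup N).map N.subtype) N := by
    refine ⟨Subgroup.map_subtype_le _, P.2.map _, ?_⟩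
    rw [Subgroup.relIndex, Subgroup.subgroupOf,
      Subgroup.comap_map_eq_self_of_injective N.subtype_injective]
    exact P.not_dvd_index
  have hmax : ICPi.MaximalICPi p ((P : Subgroup N).map N.subtype) := fun M hM =>
    (hP M hM).primePowerPi ((hS.isPGroup.to_le hM.lt.le).to_le inf_le_left)
  refine or_iff_not_imp_left.2 fun hne => le_sSup ⟨hN, ?_⟩
  exact (ICPi.cyclicBetween_of_maximalICPi hN hS hmax
    (by rwa [hcard])).cyclicChiefFactorsBelow
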